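/- Let $J,\nu$ be positive integers and $a$ a real number. Consider the following single class queueing network in discrete time, with two components $\mathcal A$ and $\mathcal B$ and queues $\mathcal A_0,\dots,\mathcal A_J$, $\mathcal B_0,\dots,\mathcal B_J$. In each time unit, each of the queues $\mathcal A_j,\mathcal B_j$, $1\le j\le J$, receives one external job with probability $a/J$ and none otherwise, independently over queues and times; $\mathcal A_0$ and $\mathcal B_0$ have no external arrivals. Jobs are unit sized. A job served at $\mathcal A_j$ (respectively $\mathcal B_j$), $1\le j\le J$, moves to $\mathcal B_0$ (respectively $\mathcal A_0$), and a job served at $\mathcal A_0$ or $\mathcal B_0$ leaves the network. The set $\mathcal S$ of feasible schedules consists of the nonnegative integer vectors $\sigma$ with $$\sigma_{\mathcal A_0}+\frac1\nu\sum_{j=1}^J\sigma_{\mathcal A_j}\le 1\quad\text{and}\quad \sigma_{\mathcal B_0}+\frac1\nu\sum_{j=1}^J\sigma_{\mathcal B_j}\le 1 .$$ In each time unit, with current queue lengths $Q$, a schedule $\sigma\in\mathcal S$ is chosen, $\min(\sigma_q,Q_q)$ jobs are served at each queue $q$, and then the served jobs and the external arrivals join their new queues. The MaxWeight policy chooses $\sigma\in\mathcal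 S$ maximizing $\sum_q Q_q\sigma_q$, where ties are broken in an arbitrary, possibly random, way depending only on $Q$. The subcritical region $\mathcal C$ is the interior of the convex hull of $\mathcal S$, and the traffic intensity $\rho$ is given by $\rho=\lambda$, where $\lambda$ solves the traffic equations, so that $\rho_{\mathcal A_0}=\rho_{\mathcal B_0}=a$ and $\rho_{\mathcal A_j}=\rho_{\mathcal B_j}=a/J$ for $1\le j\le J$. Theorem. Assume that $$a\Big(1+\frac1\nu\Big)<1,\qquad 1<\nu<J,\qquad \frac{J}{2J-\nu}<a<1-\frac{(J+\nu)(J+\nu^2)}{\nu(J^2+J+\nu^2)} .$$ Then $\rho\in\mathcal C$ and, for every way of breaking ties, the Markov chain of queue lengths under MaxWeight is transient (from every state the probability of returning to it is less than one); in particular, MaxWeight is not maximally stable for this network, where a policy is maximally stable for a network if the queue length chain is positive recurrent for all laws of external arrivals (independent over queues, i.i.d. in time, with finite means) with $\rho\in\mathcal C$. Consequently, there is a multihop single class switched network, for which MaxWeight policies exist, such that no MaxWeight policy is maximally stable for it. -/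

import Mathlib

open MeasureTheory ProbabilityTheory
open scoped ENNReal

noncomputable section

namespace MaxWeightNetwork

/-! ### Countable Markov chains -/

section MarkovChain

variable {S : Type} [Countable S] [MeasurableSpace S] [MeasurableSingletonClass S]

/-- The one-step kernel, seen as a function of the trajectory up to time `n`. -/
def historyKernel (P : S → PMF S) (n : ℕ) :
    Kernel ((_ : Finset.Iic n) → S) S where
  toFun h := (P (h ⟨n, Finset.mem_Iic.2 le_rfl⟩)).toMeasure
  measurable' := (measurable_of_countable (fun s : S => (P s).toMeasure)).comp
    (measurable_pi_apply _)

instance (P : S → PMF S) (n : ℕ) : IsMarkovKernel (historyKernel P n) :=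
  ⟨fun h => PMF.toMeasure.isProbabilityMeasure (P (h ⟨n, Finset.mem_Iic.2 le_rfl⟩))⟩

/-- The law on trajectories `ℕ → S` of the time-homogeneous Markov chain with transition
probabilities `P x y`, started at `x`. -/
def chainLaw (P : S → PMF S) (x : S) : Measure (ℕ → S) :=
  Kernel.traj (X := fun _ => S) (historyKernel P) 0 (fun _ => x)

/-- The probability, starting at `x`, of being at `y` at some time `t ≥ 1`. -/
def hitProb (P : S → PMF S) (x y : S) : ℝ≥0∞ :=
  chainLaw P x {ω | ∃ t : ℕ, 1 ≤ t ∧ ω t = y}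

open Classical in
/-- The first time `t ≥ 1` at which the trajectory is at `y` (`∞` if there is none). -/
def hitTime (y : S) (ω : ℕ → S) : ℝ≥0∞ :=
  ⨅ t : ℕ, if 1 ≤ t ∧ ω t = y then (t : ℝ≥0∞) else ⊤

/-- Transience: every state is transient, i.e. the return probability is less than one. -/
def IsTransient (P : S → PMF S) : Prop :=
  ∀ x, hitProb P x x < 1

/-- Positive recurrence. For an irreducible chain this is the usual notion (finite mean return
times); in general it says that there is a single class of positive recurrent states, and that
this class is reached almost surely from every state. -/
def IsPositiveRecurrent (P : S → PMF S) : Prop :=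
  ∃ y, (∀ x, hitProb P x y = 1) ∧ ∫⁻ ω, hitTime y ω ∂(chainLaw P y) < ⊤

end MarkovChain

/-! ### Elementary laws -/

/-- The law of a coin showing `true` with probability `q` (with `q` truncated to `[0, 1]`). -/
def coin (q : ℝ) : PMF Bool :=
  PMF.ofFintype (fun b => cond b (min (ENNReal.ofReal q) 1) (1 - min (ENNReal.ofReal q) 1))
    (by simp)

/-- The joint law of finitely many independent discrete random variables. -/
def jointLaw {κ : Type} [Fintype κ] {α : κ → Type} [∀ k, Countable (α k)]
    (μ : ∀ k, PMF (α k)) : PMF (∀ k, α k) :=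
  ⟨fun x => ∏ k, μ k (x k), by
    let _ : ∀ k, MeasurableSpace (α k) := fun _ => ⊤
    have h : (Measure.pi fun k => (μ k).toMeasure) Set.univ = 1 := measure_univ
    have h2 : ∀ x : ∀ k, α k, (Measure.pi fun k => (μ k).toMeasure) {x} = ∏ k, μ k (x k) := by
      intro x
      rw [Measure.pi_singleton]
      exact Finset.prod_congr rfl fun k _ =>
        PMF.toMeasure_apply_singleton _ _ (measurableSet_singleton _)
    have h3 : ∑' x : ∀ k, α k, ∏ k, μ k (x k) = 1 := by
      rw [← h, ← Measure.tsum_indicator_apply_singleton _ _ MeasurableSet.univ]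
      exact tsum_congr fun x => by simp [h2]
    exact h3 ▸ ENNReal.summable.hasSum⟩

/-! ### Single class switched queueing networks -/

/-- A single class switched network (without its external arrivals) with set of queues `ι`. -/
structure SwitchedNetwork (ι : Type) [Fintype ι] [DecidableEq ι] where
  /-- the feasible schedules: `σ j` is the amount of service offered to queue `j` -/
  schedules : Set (ι → ℕ)
  schedules_nonempty : schedules.Nonempty
  schedules_lower : IsLowerSet schedules
  /-- job sizes at queue `j` are geometric: each unit of work completes the job in service with
  probability `success j` -/
  success : ι → ℝ
  success_pos : ∀ j, 0 < success j
  success_le_one : ∀ j, success j ≤ 1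
  /-- the queue to which a job moves after its service at `j`; `none` means leaving the network -/
  route : ι → PMF (Option ι)
  /-- the network is open -/
  isOpen : IsUnit (1 - Matrix.of fun j j' => (route j (some j')).toReal : Matrix ι ι ℝ)

/-- Laws of the numbers of external arrivals per time unit at the different queues. -/
structure ExternalArrivals (ι : Type) where
  law : ι → PMF ℕ
  mean_ne_top : ∀ j, ∑' n : ℕ, law j n * n ≠ ⊤

/-- Mean number of external arrivals per time unit. -/
def ExternalArrivals.rate {ι : Type} (arr : ExternalArrivals ι) (j : ι) : ℝ :=
  (∑' n : ℕ, arr.law j n * n).toReal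

namespace SwitchedNetwork

variable {ι : Type} [Fintype ι] [DecidableEq ι] (N : SwitchedNetwork ι)

/-- The mean routing matrix. -/
def routingMatrix : Matrix ι ι ℝ :=
  Matrix.of fun j j' => (N.route j (some j')).toReal

/-- A network is multihop if some jobs are routed to a further queue after a service. -/
def IsMultihop : Prop := ∃ j, N.route j none ≠ 1

/-- The total arrival rates, `λ = a (1 - P)⁻¹`. -/
def totalRate (arr : ExternalArrivals ι) : ι → ℝ :=
  Matrix.vecMul arr.rate (1 - N.routingMatrix)⁻¹

/-- The traffic intensity `ρ j = λ j / p j`. -/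
def trafficIntensity (arr : ExternalArrivals ι) (j : ι) : ℝ :=
  N.totalRate arr j / N.success j

/-- The subcritical region: the interior of the convex hull of the set of schedules. -/
def subcriticalRegion : Set (ι → ℝ) :=
  interior (convexHull ℝ ((fun σ : ι → ℕ => fun j => (σ j : ℝ)) '' N.schedules))

/-- The outcome of one unit of work at queue `j`: `none` if the job in service is not completed,
`some r` if it is completed and routed to `r`. -/
def workLaw (j : ι) : PMF (Option (Option ι)) :=
  (coin (N.success j)).bind fun b => if b then (N.route j).map some else PMF.pure none

/-- The units of work executed in one time unit, for queue lengths `Q` and schedule `σ`: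
`min (σ j) (Q j)` of them at queue `j`. -/
abbrev WorkUnits (Q σ : ι → ℕ) : Type := (j : ι) × Fin (min (σ j) (Q j))

/-- The new queue lengths, given the outcomes `w` of the units of work and the external
arrivals `e`: jobs initially present are served first, then jobs arrive at their new queues.
(At most `Q i` jobs depart from `i`, so the subtraction is not truncated.) -/
def update (Q σ : ι → ℕ) (w : WorkUnits Q σ → Option (Option ι)) (e : ι → ℕ) (i : ι) : ℕ :=
  Q i - (Finset.univ.filter fun u : WorkUnits Q σ => u.1 = i ∧ w u ≠ none).card
    + (Finset.univ.filter fun u : WorkUnits Q σ => w u = some (some i)).card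
    + e i

/-- The transition probabilities of the queueing network process, under the policy that applies
a schedule with law `pol Q` when the queue lengths are `Q`. -/
def step (arr : ExternalArrivals ι) (pol : (ι → ℕ) → PMF (ι → ℕ)) (Q : ι → ℕ) : PMF (ι → ℕ) :=
  (pol Q).bind fun σ =>
    (jointLaw fun u : WorkUnits Q σ => N.workLaw u.1).bind fun w =>
      (jointLaw arr.law).map fun e => update Q σ w e

/-- `pol` is a MaxWeight policy: it only uses schedules that maximize `∑ j, Q j * σ j` over the
feasible ones. Ties are broken in an arbitrary, possibly random, way. -/
def IsMaxWeight (pol : (ι → ℕ) → PMF (ι → ℕ)) : Prop :=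
  ∀ Q, ∀ σ ∈ (pol Q).support,
    σ ∈ N.schedules ∧ ∀ σ' ∈ N.schedules, ∑ j, Q j * σ' j ≤ ∑ j, Q j * σ j

/-- A policy is maximally stable if its queueing network process is positive recurrent whenever
the traffic intensity is in the subcritical region. -/
def IsMaximallyStable (pol : (ι → ℕ) → PMF (ι → ℕ)) : Prop :=
  ∀ arr : ExternalArrivals ι, N.trafficIntensity arr ∈ N.subcriticalRegion →
    IsPositiveRecurrent (N.step arr pol)

end SwitchedNetwork

/-! ### The two-component network -/

/-- The queues of the network: the component (`true` for `𝒜`, `false` for `ℬ`), and `none` for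
the queue with index `0`, or `some j` for one of the `J` queues with external arrivals. -/
abbrev Queue (J : ℕ) : Type := Bool × Option (Fin J)

/-- Jobs move from `𝒜_j` to `ℬ_0` and from `ℬ_j` to `𝒜_0`, and leave after `𝒜_0` and `ℬ_0`. -/
def nextQueue (J : ℕ) : Queue J → Option (Queue J)
  | (_, none) => none
  | (c, some _) => some (!c, none)

/-- The two-component network: unit sized jobs, and schedules with
`σ_0 + (1/ν) ∑_{j ≥ 1} σ_j ≤ 1` in each of the two components. -/
def twoComponent (J ν : ℕ) : SwitchedNetwork (Queue J) where
  schedules := {σ | ∀ c, (σ (c, none) : ℝ) + 1 / (ν : ℝ) * ∑ j, (σ (c, some j) : ℝ) ≤ 1}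
  schedules_nonempty := ⟨0, by simp⟩
  schedules_lower := by
    intro σ σ' hle hσ c
    refine le_trans ?_ (hσ c)
    gcongr
    · exact hle _
    · exact hle _
  success _ := 1
  success_pos _ := one_pos
  success_le_one _ := le_rfl
  route i := PMF.pure (nextQueue J i)
  isOpen := by
    set P : Matrix (Queue J) (Queue J) ℝ :=
      Matrix.of fun j j' => ((PMF.pure (nextQueue J j)) (some j')).toReal with hP
    have h : P * P = 0 := by
      ext i k
      rw [Matrix.mul_apply]
      refine Finset.sum_eq_zero fun j _ => ?_
      obtain ⟨c, _ | i⟩ := i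
      · simp [hP, nextQueue, PMF.pure_apply]
      · obtain ⟨d, _ | j⟩ := j <;> simp [hP, nextQueue, PMF.pure_apply]
    have h1 : (1 - P) * (1 + P) = 1 := by
      rw [sub_mul, mul_add, mul_add, h]; simp
    have h2 : (1 + P) * (1 - P) = 1 := by
      rw [add_mul, mul_sub, mul_sub, h]; simp
    exact ⟨⟨1 - P, 1 + P, h1, h2⟩, rfl⟩

/-- External arrivals of the two-component network: at each time unit one job arrives with
probability `a / J`, and otherwise none, at each of the queues `𝒜_j`, `ℬ_j` with `j ≥ 1`. There
are no external arrivals at `𝒜_0` and `ℬ_0`. -/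
def twoComponentArrivals (J : ℕ) (a : ℝ) : ExternalArrivals (Queue J) where
  law
    | (_, none) => PMF.pure 0
    | (_, some _) => (coin (a / J)).map fun b => if b then 1 else 0
  mean_ne_top := by
    rintro ⟨c, _ | j⟩
    · simp
    · refine ne_top_of_le_ne_top (b := 1) (by simp) ?_
      calc _ ≤ ∑' n : ℕ, ((coin (a / J)).map fun b => if b then 1 else 0) n := by
            refine ENNReal.tsum_le_tsum fun n => ?_
            rcases Nat.lt_or_ge n 2 with hn | hn
            · exact mul_le_of_le_one_right' (by exact_mod_cast Nat.lt_succ_iff.mp hn)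
            · have h0 : ((coin (a / J)).map fun b => if b then 1 else 0) n = 0 := by
                rw [PMF.apply_eq_zero_iff]
                simp only [PMF.support_map, Set.mem_image, not_exists, not_and]
                rintro (_ | _) _ <;> simp <;> omega
              simp [h0]
        _ = 1 := PMF.tsum_coe _

end MaxWeightNetwork

end

/-! Fluid picture. Let one component `c` hold x jobs in queue 0 and y jobs spread evenly over its
other queues, the other component being nearly empty. MaxWeight compares x with ν times the longest
other queue. While x wins, `c` serves only queue 0: x falls at rate 1 - a, because the other
component passes on its arrivals, and y grows at rate a, so n = a x + (1 - a) y is conserved. The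
priority changes when x = ν y / J, that is at y = Y = n / (aν/J + 1 - a). From then on `c` shares
its service between queue 0 and the rest until it is empty, which happens because a + a/ν < 1.
Meanwhile its jobs flood queue 0 of the other component so fast that this queue keeps priority
there. After a time τ that component holds Y + aτ - τ jobs in queue 0 and aτ in the others, with
weight aY. The roles are then exchanged, and the weight has been multiplied by `growth`, which
exceeds 1 exactly when a > J/(2J - ν). The upper bound on a makes the flood fast enough.

The stochastic system follows this picture as long as the centred arrivals `M` of the current half
cycle stay below η = εn. Under that condition the analysis is deterministic, through the invariants
`FirstPhase` and `SecondPhase`. A half cycle takes at most Tn slots, so by a Chebyshev type estimate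
the condition fails with probability O(1/n). Weights grow geometrically, so the sum of these errors
over all later half cycles is still O(1/n) (`hitWithin_le`). A large cycle start can be reached from
every state (`exists_reachable_cycleStart`), and `hitProb_lt_one_of_reachable` turns this into
transience. Subcriticality is an explicit convex decomposition. -/

noncomputable section

namespace MaxWeightNetwork

/-! ### Expectations under discrete laws -/

/-- The expectation of `f` under the discrete law `p`. -/
def pmfExp {α : Type} (p : PMF α) (f : α → ℝ≥0∞) : ℝ≥0∞ := ∑' x, p x * f x

section PmfExp

variable {α β : Type}

lemma pmfExp_mono {p : PMF α} {f g : α → ℝ≥0∞} (h : ∀ x ∈ p.support, f x ≤ g x) :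
    pmfExp p f ≤ pmfExp p g := by
  refine ENNReal.tsum_le_tsum fun x => ?_
  by_cases hx : p x = 0
  · simp [hx]
  · exact mul_le_mul_right (h x ((PMF.mem_support_iff _ _).2 hx)) _

lemma pmfExp_const (p : PMF α) (c : ℝ≥0∞) : pmfExp p (fun _ => c) = c := by
  rw [pmfExp, ENNReal.tsum_mul_right, p.tsum_coe, one_mul]

lemma pmfExp_add (p : PMF α) (f g : α → ℝ≥0∞) :
    pmfExp p (fun x => f x + g x) = pmfExp p f + pmfExp p g := by
  simp only [pmfExp, mul_add]
  exact ENNReal.tsum_add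

lemma pmfExp_sum {κ : Type} (p : PMF α) (s : Finset κ) (f : κ → α → ℝ≥0∞) :
    pmfExp p (fun x => ∑ i ∈ s, f i x) = ∑ i ∈ s, pmfExp p (f i) := by
  simp only [pmfExp, Finset.mul_sum]
  exact Summable.tsum_finsetSum fun _ _ => ENNReal.summable

lemma pmfExp_pure (x : α) (f : α → ℝ≥0∞) : pmfExp (PMF.pure x) f = f x := by
  classical
  rw [pmfExp, tsum_eq_single x]
  · simp
  · intro y hy
    simp [hy]

lemma pmfExp_bind (p : PMF α) (q : α → PMF β) (f : β → ℝ≥0∞) :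
    pmfExp (p.bind q) f = pmfExp p fun x => pmfExp (q x) f := by
  simp only [pmfExp, PMF.bind_apply, ← ENNReal.tsum_mul_right, ← ENNReal.tsum_mul_left]
  rw [ENNReal.tsum_comm]
  simp only [mul_assoc]

lemma pmfExp_map (p : PMF α) (g : α → β) (f : β → ℝ≥0∞) :
    pmfExp (p.map g) f = pmfExp p fun x => f (g x) := by
  rw [← PMF.bind_pure_comp, pmfExp_bind]
  simp [pmfExp_pure]

lemma pmfExp_le_one {p : PMF α} {f : α → ℝ≥0∞} (h : ∀ x, f x ≤ 1) : pmfExp p f ≤ 1 :=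
  (pmfExp_mono fun x _ => h x).trans (pmfExp_const p 1).le

lemma eq_one_of_one_le_pmfExp {p : PMF α} {f : α → ℝ≥0∞} (h : ∀ x, f x ≤ 1)
    (h1 : 1 ≤ pmfExp p f) {x : α} (hx : x ∈ p.support) : f x = 1 := by
  by_contra hne
  have hlt : f x < 1 := lt_of_le_of_ne (h x) hne
  have : pmfExp p f < ∑' x, p x := by
    refine ENNReal.tsum_lt_tsum (i := x) (ne_top_of_le_ne_top ENNReal.one_ne_top
      (pmfExp_le_one h)) (fun y => mul_le_of_le_one_right' (h y)) ?_
    calc p x * f x < p x * 1 :=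
          ENNReal.mul_lt_mul_right ((PMF.mem_support_iff _ _).1 hx) (p.apply_ne_top x) hlt
      _ = p x := mul_one _
  rw [p.tsum_coe] at this
  exact absurd h1 (not_le.2 this)

lemma lintegral_toMeasure [Countable α] [MeasurableSpace α] [MeasurableSingletonClass α]
    (p : PMF α) (f : α → ℝ≥0∞) : ∫⁻ x, f x ∂p.toMeasure = pmfExp p f := by
  rw [lintegral_countable']
  exact tsum_congr fun x => by
    rw [PMF.toMeasure_apply_singleton _ _ (measurableSet_singleton x), mul_comm]

end PmfExp

/-! ### Hitting probabilities -/

section Hitting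

variable {S : Type}

open Classical in
/-- The probability, starting at `z`, of being at `y` at some time `1 ≤ t ≤ k`. -/
def hitWithin (P : S → PMF S) (y : S) : ℕ → S → ℝ≥0∞
  | 0, _ => 0
  | k + 1, z => pmfExp (P z) fun w => if w = y then 1 else hitWithin P y k w

lemma hitWithin_le_one (P : S → PMF S) (y : S) (k : ℕ) (z : S) : hitWithin P y k z ≤ 1 := by
  induction k generalizing z with
  | zero => simp [hitWithin]
  | succ k ih =>
    refine pmfExp_le_one fun w => ?_
    split_ifs
    · exact le_rfl
    · exact ih w

lemma iSup_hitWithin_le (P : S → PMF S) (y z : S) [DecidableEq S] :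
    ⨆ k, hitWithin P y k z ≤
      pmfExp (P z) fun w => if w = y then 1 else ⨆ k, hitWithin P y k w := by
  refine iSup_le fun k => ?_
  cases k with
  | zero => simp [hitWithin]
  | succ k =>
    refine pmfExp_mono fun w _ => ?_
    by_cases h : w = y
    · simp [h]
    · simpa [h] using le_iSup (fun k => hitWithin P y k w) k

variable [Countable S] [MeasurableSpace S] [MeasurableSingletonClass S]

instance (P : S → PMF S) (x : S) : IsProbabilityMeasure (chainLaw P x) := by
  unfold chainLaw; infer_instance

/-- The Markov property: the joint law of the history and the next state is the composition product
of the law of the history with `historyKernel`. -/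
lemma lintegral_chainLaw_succ (P : S → PMF S) (x : S) (n : ℕ)
    (g : ((_ : Finset.Iic n) → S) → S → ℝ≥0∞) :
    ∫⁻ ω, g (Preorder.frestrictLe n ω) (ω (n + 1)) ∂chainLaw P x =
      ∫⁻ ω, pmfExp (P (ω n)) (g (Preorder.frestrictLe n ω)) ∂chainLaw P x := by
  have hm : ∀ f : (((_ : Finset.Iic n) → S) × S) → ℝ≥0∞, Measurable f :=
    fun f => measurable_of_countable f
  have hm' : ∀ f : ((_ : Finset.Iic n) → S) → ℝ≥0∞, Measurable f :=
    fun f => measurable_of_countable f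
  have key := Kernel.partialTraj_compProd_eq_map_traj (X := fun _ => S)
    (κ := historyKernel P) (Nat.zero_le n) (x₀ := fun _ => x)
  have h1 : ∫⁻ ω, g (Preorder.frestrictLe n ω) (ω (n + 1)) ∂chainLaw P x =
      ∫⁻ z, g z.1 z.2 ∂(chainLaw P x).map fun ω => (Preorder.frestrictLe n ω, ω (n + 1)) := by
    rw [lintegral_map (hm fun z => g z.1 z.2) (by fun_prop)]
  rw [h1, chainLaw, ← key, Measure.lintegral_compProd (hm _),
    ← Kernel.traj_map_frestrictLe_apply, lintegral_map (hm' _) (by fun_prop)]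
  exact lintegral_congr fun ω => lintegral_toMeasure (P (ω n)) _

lemma chainLaw_zero_ae (P : S → PMF S) (x : S) : ∀ᵐ ω ∂chainLaw P x, ω 0 = x := by
  have h := Kernel.traj_map_frestrictLe_apply (X := fun _ => S) (κ := historyKernel P) 0 0
    (fun _ => x)
  rw [Kernel.partialTraj_self, Kernel.id_apply] at h
  have h2 : ∀ᵐ w ∂(chainLaw P x).map (Preorder.frestrictLe (π := fun _ => S) 0),
      w ⟨0, by simp⟩ = x := by
    rw [chainLaw, h, ae_dirac_iff (measurableSet_eq_fun (measurable_pi_apply _) measurable_const)]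
  exact ae_of_ae_map (by fun_prop) h2

/-- Interpolates between the trajectory law and the recursion `hitWithin`: the Markov property
trades one unit of `n` for one unit of `k` without changing the integral. -/
lemma chainLaw_hit_add_le (P : S → PMF S) (x y : S) (n k : ℕ) :
    ∫⁻ ω, (open Classical in
      if ∃ t, 1 ≤ t ∧ t ≤ n ∧ ω t = y then 1 else hitWithin P y k (ω n)) ∂chainLaw P x
      ≤ hitWithin P y (n + k) x := by
  classical
  induction n generalizing k with
  | zero =>
    have h : ∀ᵐ ω ∂chainLaw P x, (if ∃ t, 1 ≤ t ∧ t ≤ 0 ∧ ω t = y then 1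
        else hitWithin P y k (ω 0)) = hitWithin P y k x := by
      filter_upwards [chainLaw_zero_ae P x] with ω hω
      rw [if_neg, hω]
      rintro ⟨t, h1, h2, -⟩
      omega
    rw [lintegral_congr_ae h]
    simp
  | succ n ih =>
    rw [show n + 1 + k = n + (k + 1) by omega]
    refine le_trans (le_of_eq ?_) (ih (k + 1))
    let g : ((_ : Finset.Iic n) → S) → S → ℝ≥0∞ := fun h w =>
      if ∃ t : Finset.Iic n, 1 ≤ t.1 ∧ h t = y then 1
        else if w = y then 1 else hitWithin P y k w
    have hiff : ∀ ω : ℕ → S, (∃ t : Finset.Iic n, 1 ≤ t.1 ∧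
        Preorder.frestrictLe (π := fun _ => S) n ω t = y) ↔ ∃ t, 1 ≤ t ∧ t ≤ n ∧ ω t = y := by
      intro ω
      constructor
      · rintro ⟨⟨t, ht⟩, h1, h2⟩
        exact ⟨t, h1, Finset.mem_Iic.1 ht, h2⟩
      · rintro ⟨t, h1, h2, h3⟩
        exact ⟨⟨t, Finset.mem_Iic.2 h2⟩, h1, h3⟩
    calc _ = ∫⁻ ω, g (Preorder.frestrictLe n ω) (ω (n + 1)) ∂chainLaw P x := by
          refine lintegral_congr fun ω => ?_
          simp only [g, hiff]
          by_cases h : ∃ t, 1 ≤ t ∧ t ≤ n ∧ ω t = y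
          · rw [if_pos h, if_pos]
            obtain ⟨t, h1, h2, h3⟩ := h
            exact ⟨t, h1, by omega, h3⟩
          · rw [if_neg h]
            by_cases h' : ω (n + 1) = y
            · rw [if_pos h', if_pos ⟨n + 1, by omega, le_rfl, h'⟩]
            · rw [if_neg h', if_neg]
              rintro ⟨t, h1, h2, h3⟩
              rcases Nat.lt_or_ge n t with h4 | h4
              · exact h' ((show t = n + 1 by omega) ▸ h3)
              · exact h ⟨t, h1, h4, h3⟩
      _ = _ := by
          rw [lintegral_chainLaw_succ]
          refine lintegral_congr fun ω => ?_
          simp only [g, hiff]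
          by_cases h : ∃ t, 1 ≤ t ∧ t ≤ n ∧ ω t = y
          · simp only [h, if_true, pmfExp_const]
          · simp only [h, if_false, hitWithin]

lemma hitProb_le_iSup_hitWithin (P : S → PMF S) (x y : S) :
    hitProb P x y ≤ ⨆ k, hitWithin P y k x := by
  classical
  have hU : {ω : ℕ → S | ∃ t : ℕ, 1 ≤ t ∧ ω t = y} =
      ⋃ n : ℕ, {ω | ∃ t, 1 ≤ t ∧ t ≤ n ∧ ω t = y} := by
    ext ω
    simp only [Set.mem_ofPred_eq, Set.mem_iUnion]
    constructor
    · rintro ⟨t, h1, h2⟩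
      exact ⟨t, t, h1, le_rfl, h2⟩
    · rintro ⟨n, t, h1, -, h2⟩
      exact ⟨t, h1, h2⟩
  have hmono : Monotone fun n : ℕ => {ω : ℕ → S | ∃ t, 1 ≤ t ∧ t ≤ n ∧ ω t = y} := by
    rintro m n hmn ω ⟨t, h1, h2, h3⟩
    exact ⟨t, h1, h2.trans hmn, h3⟩
  rw [hitProb, hU, hmono.measure_iUnion]
  refine iSup_mono fun n => ?_
  have hmeas : MeasurableSet {ω : ℕ → S | ∃ t, 1 ≤ t ∧ t ≤ n ∧ ω t = y} := by
    simp only [Set.ofPred_exists, Set.ofPred_and]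
    refine MeasurableSet.iUnion fun t => (MeasurableSet.const _).inter
      ((MeasurableSet.const _).inter ?_)
    exact (measurableSet_singleton y).preimage (measurable_pi_apply t)
  have h := chainLaw_hit_add_le P x y n 0
  rw [add_zero] at h
  refine le_trans (le_of_eq ?_) h
  rw [← lintegral_indicator_one hmeas]
  refine lintegral_congr fun ω => ?_
  simp [Set.indicator_apply, hitWithin]

/-- If some state with an escape probability at least `1 - c > 0` can be reached from `x`, then `x`
is transient. -/
lemma hitProb_lt_one_of_reachable {P : S → PMF S} {x z : S} {c : ℝ≥0∞} (hc : c < 1)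
    (hz : ∀ k, hitWithin P x k z ≤ c)
    (hreach : Relation.ReflTransGen (fun y w => w ∈ (P y).support) x z) :
    hitProb P x x < 1 := by
  classical
  set f : S → ℝ≥0∞ := fun w => ⨆ k, hitWithin P x k w with hf
  have hf1 : ∀ w, f w ≤ 1 := fun w => iSup_le fun k => hitWithin_le_one P x k w
  by_contra hge
  have hx : f x = 1 :=
    le_antisymm (hf1 x) ((not_lt.1 hge).trans (hitProb_le_iSup_hitWithin P x x))
  -- Maximum principle: `f` is bounded by its average over the next state (with value 1 at `x`), so
  -- the maximal value 1 propagates along all possible transitions.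
  have hall : ∀ w, Relation.ReflTransGen (fun y w => w ∈ (P y).support) x w → f w = 1 := by
    intro w hw
    induction hw with
    | refl => exact hx
    | @tail y w _ hw ih =>
      have h := eq_one_of_one_le_pmfExp (f := fun w => if w = x then 1 else f w)
        (fun w => by
          split_ifs
          exacts [le_rfl, hf1 w])
        (ih ▸ iSup_hitWithin_le P x y) hw
      by_cases hwx : w = x
      · rw [hwx, hx]
      · simpa [hwx] using h
  have : f z ≤ c := iSup_le hz
  rw [hall z hreach] at this
  exact absurd hc (not_lt.2 this)

end Hitting

/-! ### Joint laws -/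

section JointLaw

variable {κ : Type} [Fintype κ] {α : κ → Type} [∀ k, Countable (α k)]

lemma mem_support_jointLaw {μ : ∀ k, PMF (α k)} {x : ∀ k, α k} :
    x ∈ (jointLaw μ).support ↔ ∀ k, x k ∈ (μ k).support := by
  simp only [PMF.mem_support_iff]
  change (∏ k, μ k (x k)) ≠ 0 ↔ _
  simp [Finset.prod_ne_zero_iff]

lemma jointLaw_pure (x : ∀ k, α k) : jointLaw (fun k => PMF.pure (x k)) = PMF.pure x := by
  classical
  ext y
  change (∏ k, PMF.pure (x k) (y k)) = _
  by_cases h : y = x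
  · subst h; simp
  · obtain ⟨k, hk⟩ := Function.ne_iff.1 h
    rw [PMF.pure_apply_of_ne _ _ h]
    exact Finset.prod_eq_zero (Finset.mem_univ k) (PMF.pure_apply_of_ne _ _ hk)

lemma pmfExp_jointLaw_eval [DecidableEq κ] (μ : ∀ k, PMF (α k)) (k : κ) (g : α k → ℝ≥0∞) :
    pmfExp (jointLaw μ) (fun x => g (x k)) = pmfExp (μ k) g := by
  let _ : ∀ k, MeasurableSpace (α k) := fun _ => ⊤
  have hpi : (jointLaw μ).toMeasure = Measure.pi fun k => (μ k).toMeasure := by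
    refine Measure.ext_of_singleton fun x => ?_
    rw [PMF.toMeasure_apply_singleton _ _ (measurableSet_singleton _), Measure.pi_singleton]
    exact Finset.prod_congr rfl fun k _ =>
      (PMF.toMeasure_apply_singleton _ _ (measurableSet_singleton _)).symm
  rw [← lintegral_toMeasure, hpi, ← lintegral_toMeasure,
    ← (measurePreserving_eval (fun k => (μ k).toMeasure) k).lintegral_comp
      (measurable_of_countable g)]

end JointLaw

lemma coin_one : coin 1 = PMF.pure true := by
  ext b
  cases b <;> simp [coin, PMF.pure_apply]

/-! ### One time slot of the two-component network -/

section Slot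

variable {J ν : ℕ}

/-- The queue lengths after a time slot, all jobs in service being completed. -/
def nextState (Q σ e : Queue J → ℕ) : Queue J → ℕ :=
  SwitchedNetwork.update Q σ (fun u => some (nextQueue J u.1)) e

lemma workLaw_twoComponent (k : Queue J) :
    (twoComponent J ν).workLaw k = PMF.pure (some (nextQueue J k)) := by
  have h1 : (twoComponent J ν).success k = 1 := rfl
  have h2 : (twoComponent J ν).route k = PMF.pure (nextQueue J k) := rfl
  rw [SwitchedNetwork.workLaw, h1, h2, coin_one, PMF.pure_bind, if_pos rfl, PMF.pure_map]

lemma step_twoComponent (arr : ExternalArrivals (Queue J))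
    (pol : (Queue J → ℕ) → PMF (Queue J → ℕ)) (Q : Queue J → ℕ) :
    (twoComponent J ν).step arr pol Q =
      (pol Q).bind fun σ => (jointLaw arr.law).map fun e => nextState Q σ e := by
  simp only [SwitchedNetwork.step, workLaw_twoComponent]
  congr 1
  funext σ
  rw [jointLaw_pure, PMF.pure_bind]
  rfl

lemma pmfExp_step_twoComponent (arr : ExternalArrivals (Queue J))
    (pol : (Queue J → ℕ) → PMF (Queue J → ℕ)) (Q : Queue J → ℕ) (f : (Queue J → ℕ) → ℝ≥0∞) :
    pmfExp ((twoComponent J ν).step arr pol Q) f =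
      pmfExp (pol Q) fun σ => pmfExp (jointLaw arr.law) fun e => f (nextState Q σ e) := by
  rw [step_twoComponent, pmfExp_bind]
  simp only [pmfExp_map]

lemma nextState_mem_support {arr : ExternalArrivals (Queue J)}
    {pol : (Queue J → ℕ) → PMF (Queue J → ℕ)} {Q σ e : Queue J → ℕ}
    (hσ : σ ∈ (pol Q).support) (he : e ∈ (jointLaw arr.law).support) :
    nextState Q σ e ∈ ((twoComponent J ν).step arr pol Q).support := by
  rw [step_twoComponent, PMF.mem_support_bind_iff]
  exact ⟨σ, hσ, (PMF.mem_support_map_iff _ _ _).2 ⟨e, he, rfl⟩⟩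

lemma card_workUnits_filter {ι : Type} [Fintype ι] [DecidableEq ι] (Q σ : ι → ℕ) (p : ι → Prop)
    [DecidablePred p] :
    (Finset.univ.filter fun u : SwitchedNetwork.WorkUnits Q σ => p u.1).card =
      ∑ k ∈ Finset.univ.filter p, min (σ k) (Q k) := by
  rw [Finset.card_filter, Fintype.sum_sigma, Finset.sum_filter]
  refine Finset.sum_congr rfl fun k _ => ?_
  by_cases h : p k <;> simp [h]

lemma nextState_some (Q σ e : Queue J → ℕ) (c : Bool) (j : Fin J) :
    nextState Q σ e (c, some j) =
      Q (c, some j) - min (σ (c, some j)) (Q (c, some j)) + e (c, some j) := by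
  have h1 := card_workUnits_filter Q σ (fun k => k = (c, some j))
  have h2 := card_workUnits_filter Q σ (fun k => nextQueue J k = some (c, some j))
  have h3 : (Finset.univ.filter fun k => nextQueue J k = some (c, some j)) = ∅ := by
    refine Finset.filter_eq_empty_iff.2 ?_
    rintro ⟨d, _ | i⟩ - <;> simp [nextQueue]
  rw [h3, Finset.sum_empty] at h2
  simp only [nextState, SwitchedNetwork.update, ne_eq, reduceCtorEq, not_false_eq_true, and_true,
    Option.some.injEq, h1, h2]
  simp [Finset.filter_eq']

lemma nextState_none (Q σ e : Queue J → ℕ) (c : Bool) :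
    nextState Q σ e (c, none) =
      Q (c, none) - min (σ (c, none)) (Q (c, none))
        + ∑ j, min (σ (!c, some j)) (Q (!c, some j)) + e (c, none) := by
  have h1 := card_workUnits_filter Q σ (fun k => k = (c, none))
  have h2 := card_workUnits_filter Q σ (fun k => nextQueue J k = some (c, none))
  simp only [nextState, SwitchedNetwork.update, ne_eq, reduceCtorEq, not_false_eq_true, and_true,
    Option.some.injEq, h1, h2]
  rw [Finset.sum_filter (fun k => nextQueue J k = some (c, none)), Fintype.sum_prod_type,
    Fintype.sum_bool, Fintype.sum_option, Fintype.sum_option]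
  cases c <;> simp [Finset.filter_eq', nextQueue]

lemma mem_schedules_iff (hν : 0 < ν) (σ : Queue J → ℕ) :
    σ ∈ (twoComponent J ν).schedules ↔
      ∀ c, ν * σ (c, none) + ∑ j, σ (c, some j) ≤ ν := by
  refine forall_congr' fun c => ?_
  have hν' : (0 : ℝ) < ν := by exact_mod_cast hν
  rw [← @Nat.cast_le ℝ]
  push_cast
  constructor
  · intro h
    have := mul_le_mul_of_nonneg_left h hν'.le
    field_simp at this
    linarith
  · intro h
    field_simp
    linarith

lemma sum_queue (f : Queue J → ℕ) (c : Bool) :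
    ∑ k, f k = (f (c, none) + ∑ j, f (c, some j)) + (f (!c, none) + ∑ j, f (!c, some j)) := by
  rw [Fintype.sum_prod_type, Fintype.sum_bool, Fintype.sum_option, Fintype.sum_option]
  cases c
  · simp only [Bool.not_false]; omega
  · simp only [Bool.not_true]

/-- `σ` maximizes the weight `∑ Q σ` among the schedules of the two-component network. -/
def MaximizesWeight (ν : ℕ) (Q σ : Queue J → ℕ) : Prop :=
  σ ∈ (twoComponent J ν).schedules ∧
    ∀ σ' ∈ (twoComponent J ν).schedules, ∑ j, Q j * σ' j ≤ ∑ j, Q j * σ j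

/-- The two components have separate constraints, so changing `σ` inside one of them keeps it
feasible, and maximality holds in each component. -/
lemma MaximizesWeight.component_le (hν : 0 < ν) {Q σ : Queue J → ℕ} (h : MaximizesWeight ν Q σ)
    (c : Bool) (s : ℕ) (d : Fin J → ℕ) (hsd : ν * s + ∑ j, d j ≤ ν) :
    Q (c, none) * s + ∑ j, Q (c, some j) * d j ≤
      Q (c, none) * σ (c, none) + ∑ j, Q (c, some j) * σ (c, some j) := by
  let σ' : Queue J → ℕ := fun k => if k.1 = c then k.2.elim s d else σ k
  have h1 : σ' ∈ (twoComponent J ν).schedules := by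
    rw [mem_schedules_iff hν]
    intro c'
    by_cases hc : c' = c
    · simpa [σ', hc] using hsd
    · simpa [σ', hc] using (mem_schedules_iff hν σ).1 h.1 c'
  have h2 := h.2 σ' h1
  rw [sum_queue _ c, sum_queue _ c] at h2
  simpa [σ'] using h2

/-- In each component, MaxWeight either serves queue `0`, or serves `ν` jobs in the longest of
the other queues. -/
lemma MaximizesWeight.component (hJ : 0 < J) (hν : 0 < ν) {Q σ : Queue J → ℕ}
    (h : MaximizesWeight ν Q σ) (c : Bool) :
    (σ (c, none) = 1 ∧ (∀ j, σ (c, some j) = 0) ∧ ∀ j, ν * Q (c, some j) ≤ Q (c, none)) ∨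
    (σ (c, none) = 0 ∧ ∑ j, σ (c, some j) ≤ ν ∧ (∃ m, Q (c, none) ≤ ν * Q (c, some m)) ∧
      (∀ j, σ (c, some j) ≠ 0 → ∀ i, Q (c, some i) ≤ Q (c, some j)) ∧
      ((∃ j, 0 < Q (c, some j)) → ∑ j, σ (c, some j) = ν)) := by
  have hs := (mem_schedules_iff hν σ).1 h.1 c
  have hν1 : σ (c, none) ≤ 1 := by
    by_contra hcon
    have : ν * 2 ≤ ν * σ (c, none) := Nat.mul_le_mul_left _ (by omega)
    omega
  have hsingle : ∀ i, Q (c, some i) * ν ≤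
      Q (c, none) * σ (c, none) + ∑ j, Q (c, some j) * σ (c, some j) := by
    intro i
    have := h.component_le hν c 0 (fun j => if j = i then ν else 0) (by simp)
    simpa using this
  rcases Nat.le_one_iff_eq_zero_or_eq_one.1 hν1 with h0 | h1
  · right
    simp only [h0, mul_zero, zero_add] at hs hsingle
    have hnone := h.component_le hν c 1 0 (by simp)
    simp only [h0, mul_one, Pi.zero_apply, mul_zero, Finset.sum_const_zero, add_zero,
      zero_add] at hnone
    obtain ⟨m, -, hm⟩ := Finset.exists_max_image Finset.univ (fun j => Q (c, some j))
      ⟨(⟨0, hJ⟩ : Fin J), Finset.mem_univ _⟩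
    have hle : ∑ j, Q (c, some j) * σ (c, some j) ≤ ∑ j, Q (c, some m) * σ (c, some j) :=
      Finset.sum_le_sum fun j _ => Nat.mul_le_mul_right _ (hm j (Finset.mem_univ j))
    have hle2 : ∑ j, Q (c, some m) * σ (c, some j) ≤ Q (c, some m) * ν := by
      rw [← Finset.mul_sum]
      exact Nat.mul_le_mul_left _ hs
    -- Giving all `ν` services to a longest queue `m` is feasible, so both inequalities are
    -- equalities: only longest queues are served, and no service is withheld if their length is
    -- positive.
    have heq := (hle.trans hle2).antisymm (hsingle m)
    have heq1 : ∑ j, Q (c, some j) * σ (c, some j) = ∑ j, Q (c, some m) * σ (c, some j) := by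
      omega
    have heq2 : Q (c, some m) * ∑ j, σ (c, some j) = Q (c, some m) * ν := by
      rw [Finset.mul_sum]; omega
    refine ⟨h0, hs, ⟨m, by rw [mul_comm]; omega⟩, fun j hj i => ?_, ?_⟩
    · have := (Finset.sum_eq_sum_iff_of_le fun j _ =>
        Nat.mul_le_mul_right (σ (c, some j)) (hm j (Finset.mem_univ j))).1 heq1 j
          (Finset.mem_univ j)
      have h2 := Nat.eq_of_mul_eq_mul_right (Nat.pos_of_ne_zero hj) this
      rw [h2]
      exact hm i (Finset.mem_univ i)
    · rintro ⟨j, hj⟩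
      exact Nat.eq_of_mul_eq_mul_left (hj.trans_le (hm j (Finset.mem_univ j))) heq2
  · left
    have hz : ∀ j, σ (c, some j) = 0 := by
      rw [h1, mul_one] at hs
      have h3 : ∑ j, σ (c, some j) = 0 := by omega
      simpa using h3
    refine ⟨h1, hz, fun j => ?_⟩
    have := hsingle j
    simp only [h1, hz, mul_one, mul_zero, Finset.sum_const_zero, add_zero] at this
    rwa [mul_comm]

/-- The dynamics of a time slot under MaxWeight, in real variables: in component `c`, `s c` jobs
leave queue `0` and `d c j` jobs leave queue `j`, and `e c j` jobs arrive at queue `j`. -/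
structure Slot (J : ℕ) (ν : ℝ) (Q Q' : Queue J → ℝ) (e : Bool → Fin J → ℝ)
    (s : Bool → ℝ) (d : Bool → Fin J → ℝ) : Prop where
  none_eq : ∀ c, Q' (c, none) = Q (c, none) - s c + ∑ j, d (!c) j
  some_eq : ∀ c j, Q' (c, some j) = Q (c, some j) - d c j + e c j
  s_nonneg : ∀ c, 0 ≤ s c
  d_nonneg : ∀ c j, 0 ≤ d c j
  mode : ∀ c,
    ((∀ j, d c j = 0) ∧ s c ≤ 1 ∧ (1 ≤ Q (c, none) → s c = 1) ∧
      ∀ j, ν * Q (c, some j) ≤ Q (c, none)) ∨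
    (s c = 0 ∧ ∑ j, d c j ≤ ν ∧ (∃ m, Q (c, none) ≤ ν * Q (c, some m)) ∧
      (∀ j, d c j ≠ 0 → d c j ≤ ν ∧ ∀ i, Q (c, some i) ≤ Q (c, some j)) ∧
      ((∃ j, ν < Q (c, some j)) → ∑ j, d c j = ν))

lemma MaximizesWeight.slot (hJ : 0 < J) (hν : 0 < ν) {Q σ e : Queue J → ℕ}
    (h : MaximizesWeight ν Q σ) (he : ∀ c, e (c, none) = 0) :
    Slot J ν (fun k => Q k) (fun k => nextState Q σ e k) (fun c j => e (c, some j))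
      (fun c => (min (σ (c, none)) (Q (c, none)) : ℕ))
      (fun c j => (min (σ (c, some j)) (Q (c, some j)) : ℕ)) where
  none_eq c := by
    simp only [nextState_none, he, add_zero]
    push_cast [Nat.cast_sub (min_le_right (σ (c, none)) (Q (c, none)))]
    ring
  some_eq c j := by
    simp only [nextState_some]
    push_cast [Nat.cast_sub (min_le_right (σ (c, some j)) (Q (c, some j)))]
    ring
  s_nonneg c := Nat.cast_nonneg _
  d_nonneg c j := Nat.cast_nonneg _
  mode c := by
    rcases h.component hJ hν c with ⟨h1, h2, h3⟩ | ⟨h1, h2, ⟨m, h3⟩, h4, h5⟩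
    · left
      refine ⟨fun j => by simp [h2], ?_, ?_, fun j => by exact_mod_cast h3 j⟩
      · rw [h1]; exact_mod_cast min_le_left _ _
      · intro hq
        rw [h1, min_eq_left (by exact_mod_cast hq)]
        simp
    · right
      have hsum : ∑ j, min (σ (c, some j)) (Q (c, some j)) ≤ ∑ j, σ (c, some j) :=
        Finset.sum_le_sum fun j _ => min_le_left _ _
      refine ⟨by simp [h1], by exact_mod_cast hsum.trans h2, ⟨m, by exact_mod_cast h3⟩, ?_, ?_⟩
      · intro j hj
        have hσj : σ (c, some j) ≠ 0 := by
          rintro h0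
          simp [h0] at hj
        refine ⟨?_, fun i => by exact_mod_cast h4 j hσj i⟩
        have : min (σ (c, some j)) (Q (c, some j)) ≤ ν :=
          (min_le_left _ _).trans ((Finset.single_le_sum
            (f := fun j => σ (c, some j)) (fun _ _ => Nat.zero_le _) (Finset.mem_univ j)).trans h2)
        exact_mod_cast this
      · rintro ⟨j, hj⟩
        have hj : ν < Q (c, some j) := by exact_mod_cast hj
        have h6 := h5 ⟨j, by omega⟩
        -- Served queues are longest, hence hold more than `ν` jobs, so none of the offered services
        -- is wasted.
        have : ∑ j, min (σ (c, some j)) (Q (c, some j)) = ν := by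
          rw [← h6]
          refine Finset.sum_congr rfl fun i _ => min_eq_left ?_
          by_cases hi : σ (c, some i) = 0
          · omega
          · have h7 := h4 i hi j
            have h8 : σ (c, some i) ≤ ν := h6 ▸ Finset.single_le_sum
              (f := fun j => σ (c, some j)) (fun _ _ => Nat.zero_le _) (Finset.mem_univ i)
            omega
        exact_mod_cast this

end Slot

/-! ### The arrivals -/

section Arrivals

variable {J : ℕ} {a : ℝ}

lemma arrivals_none {e : Queue J → ℕ}
    (he : e ∈ (jointLaw (twoComponentArrivals J a).law).support) (c : Bool) : e (c, none) = 0 := by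
  have := mem_support_jointLaw.1 he (c, none)
  simpa [twoComponentArrivals] using this

lemma mem_support_arrivals (h0 : 0 < a / J) (h1 : a / J < 1) {e : Queue J → ℕ}
    (he : ∀ c, e (c, none) = 0) (he' : ∀ c j, e (c, some j) ≤ 1) :
    e ∈ (jointLaw (twoComponentArrivals J a).law).support := by
  rw [mem_support_jointLaw]
  rintro ⟨c, _ | j⟩
  · simp [twoComponentArrivals, he]
  · have hlaw : (twoComponentArrivals J a).law (c, some j) =
        (coin (a / J)).map fun b => if b then 1 else 0 := rfl
    rw [hlaw, PMF.mem_support_map_iff]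
    have h2 : ENNReal.ofReal (a / J) < 1 := by
      rw [← ENNReal.ofReal_one]
      exact (ENNReal.ofReal_lt_ofReal_iff one_pos).2 h1
    rcases Nat.le_one_iff_eq_zero_or_eq_one.1 (he' c j) with h | h
    · refine ⟨false, ?_, by simp [h]⟩
      rw [PMF.mem_support_iff]
      simpa [coin, h2.le] using (tsub_pos_of_lt h2).ne'
    · refine ⟨true, ?_, by simp [h]⟩
      rw [PMF.mem_support_iff]
      simp [coin, h2.le, h0]

/-- A centred arrival has mean zero, so the cross term vanishes, and its variance is at most 1. -/
lemma pmfExp_sq_arrival_le (h0 : 0 ≤ a / J) (h1 : a / J ≤ 1) (m : ℝ) (c : Bool) (j : Fin J) :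
    pmfExp (jointLaw (twoComponentArrivals J a).law)
      (fun e => ENNReal.ofReal ((m + e (c, some j) - a / J) ^ 2)) ≤ ENNReal.ofReal (m ^ 2 + 1) := by
  rw [pmfExp_jointLaw_eval (twoComponentArrivals J a).law (c, some j)
    (fun n => ENNReal.ofReal ((m + n - a / J) ^ 2))]
  have hlaw : (twoComponentArrivals J a).law (c, some j) =
      (coin (a / J)).map fun b => if b then 1 else 0 := rfl
  have h2 : ENNReal.ofReal (a / J) ≤ 1 := by
    rw [← ENNReal.ofReal_one]
    exact ENNReal.ofReal_le_ofReal h1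
  have ht : coin (a / J) true = ENNReal.ofReal (a / J) := by simp [coin, h2]
  have hf : coin (a / J) false = ENNReal.ofReal (1 - a / J) := by
    rw [ENNReal.ofReal_sub _ h0]; simp [coin, h2]
  rw [hlaw, pmfExp_map, pmfExp, tsum_fintype, Fintype.sum_bool, ht, hf,
    ← ENNReal.ofReal_mul h0, ← ENNReal.ofReal_mul (by linarith),
    ← ENNReal.ofReal_add (mul_nonneg h0 (sq_nonneg _)) (mul_nonneg (by linarith) (sq_nonneg _))]
  refine ENNReal.ofReal_le_ofReal ?_
  simp only [if_true, Bool.false_eq_true, if_false]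
  push_cast
  nlinarith [sq_nonneg (a / J)]

end Arrivals

/-! ### Pathwise analysis of half a cycle -/

section HalfCycle

/-- Standing assumptions on the parameters and on the size `η` of the fluctuations. -/
structure Regime (J : ℕ) (ν a η : ℝ) : Prop where
  J_one : (1 : ℝ) ≤ J
  ν_one : 1 ≤ ν
  a_pos : 0 < a
  a_lt : a < 1
  load : a + a / ν < 1
  η_ge : J * ν ^ 2 ≤ η

/-- Component `c` is almost empty. -/
def Drained {J : ℕ} (ν : ℝ) (c : Bool) (Q : Queue J → ℝ) : Prop :=
  Q (c, none) ≤ ν ^ 2 ∧ ∀ j, Q (c, some j) ≤ ν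

/-- The fluctuations after a time slot with arrivals `e`. -/
def nextNoise (J : ℕ) (a : ℝ) (M e : Bool → Fin J → ℝ) : Bool → Fin J → ℝ :=
  fun c j => M c j + e c j - a / J

variable {J : ℕ} {ν a η : ℝ} {c : Bool} {Q Q' : Queue J → ℝ} {e : Bool → Fin J → ℝ}
  {M : Bool → Fin J → ℝ}

namespace Regime

variable (R : Regime J ν a η)
include R

/-- These bounds let `η` absorb the jumps of a single slot and the contents of a drained component.
-/
lemma η_bounds : 1 ≤ η ∧ ν ≤ η ∧ ν ^ 2 ≤ η ∧ J * ν ≤ η := by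
  have h1 := R.J_one
  have h2 := R.ν_one
  have h3 := R.η_ge
  have h4 : ν ≤ ν ^ 2 := by nlinarith
  have h5 : ν ^ 2 ≤ J * ν ^ 2 := by nlinarith [sq_nonneg ν]
  have h6 : (J : ℝ) * ν ≤ J * ν ^ 2 := by gcongr
  refine ⟨?_, ?_, ?_, ?_⟩ <;> linarith

lemma J_mul : (J : ℝ) * (a / J) = a := by
  have := R.J_one
  field_simp

lemma sum_nextNoise (M e : Bool → Fin J → ℝ) (c : Bool) :
    ∑ j, nextNoise J a M e c j = ∑ j, M c j + ∑ j, e c j - a := by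
  simp only [nextNoise, Finset.sum_sub_distrib, Finset.sum_add_distrib, Finset.sum_const,
    Finset.card_univ, Fintype.card_fin, nsmul_eq_mul, R.J_mul]

end Regime

lemma abs_sum_le_of_abs_le {f : Fin J → ℝ} (h : ∀ j, |f j| ≤ η) : |∑ j, f j| ≤ J * η := by
  refine (Finset.abs_sum_le_sum_abs _ _).trans ((Finset.sum_le_sum fun j _ => h j).trans ?_)
  simp

lemma sum_le_card_mul {f : Fin J → ℝ} {b : ℝ} (h : ∀ j, f j ≤ b) : ∑ j, f j ≤ J * b := by
  refine (Finset.sum_le_sum fun j _ => h j).trans ?_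
  simp

lemma sum_single_le (f : Fin J → ℝ) (h : ∀ j, 0 ≤ f j) (j : Fin J) : f j ≤ ∑ j, f j :=
  Finset.single_le_sum (fun i _ => h i) (Finset.mem_univ j)

variable {s : Bool → ℝ} {d : Bool → Fin J → ℝ}

namespace Slot

lemma sum_some (S : Slot J ν Q Q' e s d) (c : Bool) :
    ∑ j, Q' (c, some j) = ∑ j, Q (c, some j) - ∑ j, d c j + ∑ j, e c j := by
  simp only [S.some_eq, Finset.sum_add_distrib, Finset.sum_sub_distrib]

/-- Apart from fluctuations, a gap can only widen when the shorter queue `j` is served. But then `j`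
is a longest queue before the slot, so the new gap is at most `ν + 2 * η`. -/
lemma even_step (S : Slot J ν Q Q' e s d) (c : Bool) {K : ℝ} (hK : ν + 2 * η ≤ K)
    (hM : ∀ c j, |M c j| ≤ η)
    (h : ∀ i j, (Q (c, some i) - M c i) - (Q (c, some j) - M c j) ≤ K) (i j : Fin J) :
    (Q' (c, some i) - nextNoise J a M e c i) - (Q' (c, some j) - nextNoise J a M e c j) ≤ K := by
  have h0 := h i j
  have hi := S.d_nonneg c i
  have hMi := abs_le.1 (hM c i)
  have hMj := abs_le.1 (hM c j)
  rw [S.some_eq, S.some_eq, nextNoise, nextNoise]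
  by_cases hd : d c j = 0
  · linarith
  · rcases S.mode c with ⟨h1, -⟩ | ⟨-, -, -, h4, -⟩
    · exact absurd (h1 j) hd
    · obtain ⟨h5, h6⟩ := h4 j hd
      have := h6 i
      linarith

/-- While component `c` is not drained, it works at full speed. -/
lemma work (S : Slot J ν Q Q' e s d) (hν : 1 ≤ ν) (c : Bool) (hc : ¬ Drained ν c Q) :
    ((∀ j, d c j = 0) ∧ s c = 1 ∧ ∀ j, ν * Q (c, some j) ≤ Q (c, none)) ∨
    (s c = 0 ∧ ∑ j, d c j = ν ∧ ∃ m, Q (c, none) ≤ ν * Q (c, some m)) := by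
  have hν2 : 1 ≤ ν ^ 2 := one_le_pow₀ hν
  -- The thresholds in `Drained` fit both ways of wasting service: queue 0 has priority with less
  -- than one job, or the other queues have priority and none exceeds `ν`.
  rcases S.mode c with ⟨h1, -, h3, h4⟩ | ⟨h1, h2, ⟨m, h3⟩, -, h5⟩
  · refine Or.inl ⟨h1, h3 ?_, h4⟩
    by_contra hlt
    refine hc ⟨by linarith, fun j => ?_⟩
    have := h4 j
    by_contra hj
    nlinarith
  · refine Or.inr ⟨h1, h5 ?_, m, h3⟩
    by_contra hj
    push Not at hj
    refine hc ⟨?_, hj⟩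
    have := hj m
    nlinarith

end Slot

/-- The invariant of the first phase, in which component `c` serves queue `0`. -/
structure FirstPhase (ν a η n W : ℝ) (c : Bool) (t : ℝ) (Q : Queue J → ℝ)
    (M : Bool → Fin J → ℝ) : Prop where
  even : ∀ i j, (Q (c, some i) - M c i) - (Q (c, some j) - M c j) ≤ 5 * η
  even_other : ∀ i j, (Q (!c, some i) - M (!c) i) - (Q (!c, some j) - M (!c) j) ≤ 3 * η
  weight : n ≤ a * Q (c, none) + (1 - a) * (∑ j, Q (c, some j) - ∑ j, M c j)
    + a * (∑ j, Q (!c, some j) - ∑ j, M (!c) j)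
  other_none : Q (!c, none) ≤ η
  other_sum : ∑ j, Q (!c, some j) - ∑ j, M (!c) j ≤ (2 * J + 1) * η
  work : Q (c, none) + (∑ j, Q (!c, some j) - ∑ j, M (!c) j)
    + (∑ j, Q (c, some j) - ∑ j, M c j) / ν + (1 - a - a / ν) * t ≤ W

/-- The invariant of the second phase, in which component `c` is emptied while queue `0` of the
other component fills. The second phase has lasted for time `τ`, and `Y` and `G` are the numbers of
jobs and the work in component `c` at its beginning, up to fluctuations. -/
structure SecondPhase (ν a η n W C : ℝ) (c : Bool) (t : ℝ) (Q : Queue J → ℝ)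
    (M : Bool → Fin J → ℝ) (τ Y G : ℝ) : Prop where
  τ_nonneg : 0 ≤ τ
  even_other : ∀ i j, (Q (!c, some i) - M (!c) i) - (Q (!c, some j) - M (!c) j) ≤ 3 * η
  work : Q (c, none) + (∑ j, Q (!c, some j) - ∑ j, M (!c) j)
    + (∑ j, Q (c, some j) - ∑ j, M c j) / ν ≤ G - (1 - a - a / ν) * τ
  work_start : G + (1 - a - a / ν) * (t - τ) ≤ W
  balance : G ≤ ν / J * Y + Y / ν + (8 * ν + 2 * J + 1) * η
  size : n ≤ (a * ν / J + 1 - a) * Y + (8 * ν + 2 * J + 1) * η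
  fill : (1 - a) * τ ≤ (Y + a * τ + ∑ j, M c j - ∑ j, Q (c, some j)) * (1 / ν + ν / J)
    + (9 * ν + 3 * J + 2) * η
  other_none : Y + a * τ + ∑ j, M c j - ∑ j, Q (c, some j) - τ ≤ Q (!c, none)
  other_some : ∀ j, Q (!c, some j) - M (!c) j ≤ (3 * J + 2) * η + a / J * τ
  weight : a * Y - J * η - (1 - a) * ν * min τ (C * η + 1) ≤ a * Q (!c, none)
    + (1 - a) * (∑ j, Q (!c, some j) - ∑ j, M (!c) j)
    + a * (∑ j, Q (c, some j) - ∑ j, M c j)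

variable {n W t C τ Y G : ℝ}

/-- If `c` were drained, all terms of `weight` would be of order `η`. Hence a half cycle can end
only in its second phase. -/
lemma FirstPhase.not_drained (R : Regime J ν a η) (hM : ∀ c j, |M c j| ≤ η)
    (hn : (4 * J + 4) * η < n) (h : FirstPhase ν a η n W c t Q M) : ¬ Drained ν c Q := by
  rintro ⟨h1, h2⟩
  obtain ⟨-, -, hη2, hηJ⟩ := R.η_bounds
  have h3 := sum_le_card_mul h2
  have h4 := abs_le.1 (abs_sum_le_of_abs_le (hM c))
  have h5 := h.weight
  have h6 := h.other_sum
  have := R.a_pos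
  have := R.a_lt
  have hJ := R.J_one
  have h7 : a * Q (c, none) ≤ 1 * η := by
    have : a * Q (c, none) ≤ a * η := by gcongr; linarith
    nlinarith
  have h8 : (1 - a) * (∑ j, Q (c, some j) - ∑ j, M c j) ≤ 1 * (η + J * η) := by
    have : (1 - a) * (∑ j, Q (c, some j) - ∑ j, M c j) ≤ (1 - a) * (η + J * η) := by
      gcongr
      · linarith
    nlinarith
  have h9 : a * (∑ j, Q (!c, some j) - ∑ j, M (!c) j) ≤ 1 * ((2 * J + 1) * η) := by
    have : a * (∑ j, Q (!c, some j) - ∑ j, M (!c) j) ≤ a * ((2 * J + 1) * η) := by gcongr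
    nlinarith
  nlinarith

/-- Jobs in the queues `j` of the other component count like jobs in queue 0 of `c`, their next
queue. With this convention the right side of `weight` is exactly conserved, and the workload in
`work` falls by `1 - a - a / ν` per slot. -/
lemma FirstPhase.step (R : Regime J ν a η) (S : Slot J ν Q Q' e s d)
    (hM : ∀ c j, |M c j| ≤ η) (hQ : ∀ k, 0 ≤ Q k)
    (h : FirstPhase ν a η n W c t Q M) (hd : ∀ j, d c j = 0) (hs : s c = 1) :
    FirstPhase ν a η n W c (t + 1) Q' (nextNoise J a M e) := by
  obtain ⟨hη1, hην, hη2, hηJ⟩ := R.η_bounds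
  have ha := R.a_pos
  have ha1 := R.a_lt
  have hJ := R.J_one
  have hν := R.ν_one
  have hdsum : ∑ j, d c j = 0 := by simp [hd]
  have hx := S.none_eq c
  have hu := S.none_eq (!c)
  rw [Bool.not_not] at hu
  have hy := S.sum_some c
  have hv := S.sum_some (!c)
  have hm := R.sum_nextNoise M e c
  have hm' := R.sum_nextNoise M e (!c)
  have hyy : ∑ j, Q' (c, some j) - ∑ j, nextNoise J a M e c j
      = ∑ j, Q (c, some j) - ∑ j, M c j + a := by linarith
  have hvv : ∑ j, Q' (!c, some j) - ∑ j, nextNoise J a M e (!c) j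
      = ∑ j, Q (!c, some j) - ∑ j, M (!c) j + a - ∑ j, d (!c) j := by linarith
  have hs' := S.s_nonneg (!c)
  refine ⟨S.even_step c (by linarith) hM h.even, S.even_step (!c) (by linarith) hM h.even_other,
    ?_, ?_, ?_, ?_⟩
  · rw [hyy, hvv, hx, hs]
    linarith [h.weight]
  · rw [hu, hdsum]
    linarith [h.other_none]
  · rw [hvv]
    have h1 := h.other_sum
    have h2 := h.other_none
    have h3 : 0 ≤ ∑ j, d (!c) j := Finset.sum_nonneg fun j _ => S.d_nonneg _ j
    have h4 := abs_le.1 (abs_sum_le_of_abs_le (hM (!c)))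
    -- Either these queues are short, or they are served at rate `ν`, which exceeds their arrival
    -- rate `a`.
    have h5 : ∑ j, Q (!c, some j) ≤ J * η ∨ ∑ j, d (!c) j = ν := by
      rcases S.mode (!c) with ⟨-, -, -, h6⟩ | ⟨-, -, -, -, h6⟩
      · left
        refine sum_le_card_mul fun j => ?_
        have := h6 j
        have := hQ (!c, some j)
        nlinarith
      · by_cases h7 : ∃ j, ν < Q (!c, some j)
        · exact Or.inr (h6 h7)
        · push Not at h7
          left
          refine sum_le_card_mul fun j => ?_
          linarith [h7 j]
    rcases h5 with h5 | h5 <;> linarith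
  · rw [hyy, hvv, hx, hs, add_div]
    linarith [h.work]

/-- At the change of priority, queue `m` exceeds every other by at most `7 * η`: `5 * η` from
evenness and `2 * η` from fluctuations. So queue 0 is at most about `ν / J` times the total `Y`, and
the conserved weight then bounds `Y` from below. -/
lemma FirstPhase.second (R : Regime J ν a η) (hM : ∀ c j, |M c j| ≤ η)
    (hQ : ∀ k, 0 ≤ Q k) (hC : 0 ≤ C) (h : FirstPhase ν a η n W c t Q M) {m : Fin J}
    (hx : Q (c, none) ≤ ν * Q (c, some m)) :
    SecondPhase ν a η n W C c t Q M 0 (∑ j, Q (c, some j) - ∑ j, M c j)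
      (Q (c, none) + (∑ j, Q (!c, some j) - ∑ j, M (!c) j)
        + (∑ j, Q (c, some j) - ∑ j, M c j) / ν) := by
  obtain ⟨hη1, hην, hη2, hηJ⟩ := R.η_bounds
  have ha := R.a_pos
  have ha1 := R.a_lt
  have hJ := R.J_one
  have hν := R.ν_one
  have h4 := abs_le.1 (abs_sum_le_of_abs_le (hM (!c)))
  have h4' := abs_le.1 (abs_sum_le_of_abs_le (hM c))
  have h5 := h.other_sum
  have hxb : Q (c, none) ≤ ν / J * (∑ j, Q (c, some j) - ∑ j, M c j) + 8 * ν * η := by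
    have h1 : J * Q (c, some m) ≤ ∑ j, Q (c, some j) + J * (7 * η) := by
      have : ∑ _j : Fin J, (Q (c, some m) - 7 * η) ≤ ∑ j, Q (c, some j) := by
        refine Finset.sum_le_sum fun j _ => ?_
        have := h.even m j
        have := abs_le.1 (hM c m)
        have := abs_le.1 (hM c j)
        linarith
      simp only [Finset.sum_const, Finset.card_univ, Fintype.card_fin, nsmul_eq_mul] at this
      linarith
    have h2 : J * Q (c, none) ≤ ν * (∑ j, Q (c, some j) - ∑ j, M c j) + J * (8 * ν * η) := by
      calc J * Q (c, none) ≤ J * (ν * Q (c, some m)) := by gcongr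
        _ = ν * (J * Q (c, some m)) := by ring
        _ ≤ ν * (∑ j, Q (c, some j) + J * (7 * η)) := by gcongr
        _ ≤ ν * (∑ j, Q (c, some j) - ∑ j, M c j + J * (8 * η)) :=
          mul_le_mul_of_nonneg_left (by linarith) (by linarith)
        _ = _ := by ring
    have h3 : ν / J * (∑ j, Q (c, some j) - ∑ j, M c j) + 8 * ν * η =
        (ν * (∑ j, Q (c, some j) - ∑ j, M c j) + J * (8 * ν * η)) / J := by
      field_simp
    rw [h3, le_div_iff₀ (by linarith)]
    linarith
  refine ⟨le_rfl, h.even_other, by simp, by simpa using h.work, ?_, ?_, ?_, ?_, ?_, ?_⟩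
  · linarith
  · have h1 := h.weight
    have h2 : a * Q (c, none) ≤ a * ν / J * (∑ j, Q (c, some j) - ∑ j, M c j) + 8 * ν * η := by
      calc a * Q (c, none) ≤ a * (ν / J * (∑ j, Q (c, some j) - ∑ j, M c j) + 8 * ν * η) := by
            gcongr
        _ = a * ν / J * (∑ j, Q (c, some j) - ∑ j, M c j) + a * (8 * ν * η) := by ring
        _ ≤ _ := by
          have : a * (8 * ν * η) ≤ 1 * (8 * ν * η) := by gcongr
          linarith
    have h3 : a * (∑ j, Q (!c, some j) - ∑ j, M (!c) j) ≤ 1 * ((2 * J + 1) * η) := by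
      calc _ ≤ a * ((2 * J + 1) * η) := by gcongr
        _ ≤ _ := by gcongr
    linarith
  · simp only [mul_zero, add_zero, sub_add_cancel, sub_self, zero_mul, zero_add]
    positivity
  · simpa using hQ (!c, none)
  · intro j
    have h1 := sum_single_le (fun j => Q (!c, some j)) (fun j => hQ _) j
    have h2 := abs_le.1 (hM (!c) j)
    linarith
  · have h1 : 0 ≤ a * Q (!c, none) := mul_nonneg ha.le (hQ _)
    have h2 : 0 ≤ ∑ j, Q (!c, some j) := Finset.sum_nonneg fun j _ => hQ _
    have h3 : (1 - a) * (-(J * η)) ≤ (1 - a) * (∑ j, Q (!c, some j) - ∑ j, M (!c) j) := by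
      gcongr
      linarith
    have h6 : (0 : ℝ) ≤ J * η := by positivity
    rw [min_eq_left (by positivity)]
    nlinarith

/-- After a short time into the second phase, the other component only serves queue `0`. -/
lemma SecondPhase.time_le (R : Regime J ν a η)
    (hfill : 1 + ν * a / J < ν * (1 - a) * J / (J + ν ^ 2))
    (hC : C = ν * (9 * ν + 6 * J + 5) / (ν * (1 - a) * J / (J + ν ^ 2) - 1 - ν * a / J))
    (hM : ∀ c j, |M c j| ≤ η) (h : SecondPhase ν a η n W C c t Q M τ Y G) {m : Fin J}
    (hx : Q (!c, none) ≤ ν * Q (!c, some m)) : τ ≤ C * η := by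
  have ha := R.a_pos
  have hJ := R.J_one
  have hν := R.ν_one
  obtain ⟨hη1, hην, hη2, hηJ⟩ := R.η_bounds
  have h1 := h.fill
  have h2 := h.other_none
  have h3 := h.other_some m
  have h4 := abs_le.1 (hM (!c) m)
  -- `D` counts the jobs sent over by `c` in the second phase. By `fill` it grows at rate at least
  -- `ν * (1 - a) * J / (J + ν ^ 2)`, while `hx` forces `D` to be at most `(1 + ν * a / J) * τ` up
  -- to multiples of `η`. The gap in `hfill` bounds `τ`.
  set D := Y + a * τ + ∑ j, M c j - ∑ j, Q (c, some j) with hD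
  have h5 : D - τ ≤ ν * ((3 * J + 3) * η + a / J * τ) := by
    have : ν * Q (!c, some m) ≤ ν * ((3 * J + 3) * η + a / J * τ) := by gcongr; linarith
    linarith
  have hpos : 0 < ν * (1 - a) * J / (J + ν ^ 2) - 1 - ν * a / J := by linarith
  rw [hC, div_mul_eq_mul_div, le_div_iff₀ hpos]
  have hq : ν * J / (J + ν ^ 2) * (1 / ν + ν / J) = 1 := by
    field_simp
  have hq0 : 0 ≤ ν * J / (J + ν ^ 2) := by positivity
  have hq1 : ν * J / (J + ν ^ 2) ≤ ν := by
    rw [div_le_iff₀ (by positivity)]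
    nlinarith [mul_nonneg (by linarith : 0 ≤ ν) (sq_nonneg ν)]
  have h6 : ν * J / (J + ν ^ 2) * ((1 - a) * τ) ≤ D + ν * ((9 * ν + 3 * J + 2) * η) := by
    calc _ ≤ ν * J / (J + ν ^ 2) * (D * (1 / ν + ν / J) + (9 * ν + 3 * J + 2) * η) := by gcongr
      _ = D * (ν * J / (J + ν ^ 2) * (1 / ν + ν / J))
          + ν * J / (J + ν ^ 2) * ((9 * ν + 3 * J + 2) * η) := by ring
      _ ≤ _ := by
        rw [hq, mul_one]
        gcongr
  have h7 : ν * J / (J + ν ^ 2) * ((1 - a) * τ) = ν * (1 - a) * J / (J + ν ^ 2) * τ := by ring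
  have h8 : ν * (a / J * τ) = ν * a / J * τ := by ring
  rw [h7] at h6
  linarith

lemma SecondPhase.step (R : Regime J ν a η)
    (hfill : 1 + ν * a / J < ν * (1 - a) * J / (J + ν ^ 2))
    (hC : C = ν * (9 * ν + 6 * J + 5) / (ν * (1 - a) * J / (J + ν ^ 2) - 1 - ν * a / J))
    (S : Slot J ν Q Q' e s d) (hM : ∀ c j, |M c j| ≤ η) (hQ : ∀ k, 0 ≤ Q k)
    (hc : ¬ Drained ν c Q) (h : SecondPhase ν a η n W C c t Q M τ Y G) :
    SecondPhase ν a η n W C c (t + 1) Q' (nextNoise J a M e) (τ + 1) Y G := by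
  obtain ⟨hη1, hην, hη2, hηJ⟩ := R.η_bounds
  have ha := R.a_pos
  have ha1 := R.a_lt
  have hJ := R.J_one
  have hν := R.ν_one
  have hx := S.none_eq c
  have hu := S.none_eq (!c)
  rw [Bool.not_not] at hu
  have hy := S.sum_some c
  have hv := S.sum_some (!c)
  have hm := R.sum_nextNoise M e c
  have hm' := R.sum_nextNoise M e (!c)
  have hyy : ∑ j, Q' (c, some j) - ∑ j, nextNoise J a M e c j
      = ∑ j, Q (c, some j) - ∑ j, M c j + a - ∑ j, d c j := by linarith
  have hvv : ∑ j, Q' (!c, some j) - ∑ j, nextNoise J a M e (!c) j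
      = ∑ j, Q (!c, some j) - ∑ j, M (!c) j + a - ∑ j, d (!c) j := by linarith
  have hD : Y + a * (τ + 1) + ∑ j, nextNoise J a M e c j - ∑ j, Q' (c, some j)
      = Y + a * τ + ∑ j, M c j - ∑ j, Q (c, some j) + ∑ j, d c j := by linarith
  have hs1 : s (!c) ≤ 1 := by
    rcases S.mode (!c) with ⟨-, h1, -⟩ | ⟨h1, -⟩ <;> linarith
  have hwork := S.work hν c hc
  refine ⟨by linarith [h.τ_nonneg], S.even_step (!c) (by linarith) hM h.even_other, ?_,
    by linarith [h.work_start], h.balance, h.size, ?_, ?_, ?_, ?_⟩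
  · rw [hx, hyy, hvv]
    have h1 := h.work
    have h2 : s c + (∑ j, d c j) / ν = 1 := by
      rcases hwork with ⟨h2, h3, -⟩ | ⟨h2, h3, -⟩
      · simp [h2, h3]
      · rw [h2, h3, zero_add, div_self (by linarith)]
    rw [sub_div, add_div]
    linarith
  · rw [hD]
    have h1 := h.fill
    have h2 := h.work
    have h3 := h.balance
    -- If queue 0 is served, it dominates `ν / J` times the rest, so the bound on the work limits
    -- the jobs left in the queues `j` and yields `fill` directly. Otherwise `D` grows by `ν`, more
    -- than enough for one slot.
    rcases hwork with ⟨hd, -, hmax⟩ | ⟨-, hd, -⟩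
    · simp only [hd, Finset.sum_const_zero, add_zero]
      have h4 : ν / J * ∑ j, Q (c, some j) ≤ Q (c, none) := by
        have h5 : ν * ∑ j, Q (c, some j) ≤ J * Q (c, none) := by
          rw [Finset.mul_sum]
          exact sum_le_card_mul hmax
        rw [div_mul_eq_mul_div, div_le_iff₀ (by linarith)]
        linarith
      have h6 : 0 ≤ ∑ j, Q (!c, some j) := Finset.sum_nonneg fun j _ => hQ _
      have h7 := abs_le.1 (abs_sum_le_of_abs_le (hM (!c)))
      have h8 := abs_le.1 (abs_sum_le_of_abs_le (hM c))
      have hτ := h.τ_nonneg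
      have h9 : -(ν * η) ≤ ν / J * ∑ j, M c j := by
        have : ν / J * (-(J * η)) ≤ ν / J * ∑ j, M c j := by gcongr; exact h8.1
        have h10 : ν / J * (-(J * η)) = -(ν * η) := by field_simp
        linarith
      have h11 : 0 ≤ ν / J * (a * τ) := by positivity
      have h12 : (∑ j, Q (c, some j) - ∑ j, M c j) / ν =
        ∑ j, Q (c, some j) * (1 / ν) - (∑ j, M c j) * (1 / ν) := by
          rw [← Finset.sum_mul]; ring
      rw [h12, ← Finset.sum_mul] at h2
      have h13 : a / ν * τ = a * τ * (1 / ν) := by ring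
      have h14 : Y / ν = Y * (1 / ν) := by ring
      rw [h14] at h3
      nlinarith
    · rw [hd, add_mul]
      have h4 : 1 ≤ ν * (1 / ν + ν / J) := by
        have : ν * (1 / ν + ν / J) = 1 + ν * (ν / J) := by field_simp
        rw [this]
        have : 0 ≤ ν * (ν / J) := by positivity
        linarith
      linarith
  · rw [hD, hu]
    linarith [h.other_none]
  · intro j
    rw [S.some_eq, nextNoise]
    linarith [h.other_some j, S.d_nonneg (!c) j]
  · rw [hu, hvv, hyy]
    have h1 := h.weight
    -- The right side of `weight` changes by `a * (1 - s (!c))` minus `1 - a` times the number of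
    -- jobs served in the queues `j` of the filling component. Such services occur only while `τ ≤ C
    -- * η`, which explains the minimum in the loss term.
    rcases S.mode (!c) with ⟨hd, h2, -⟩ | ⟨hs0, h2, ⟨m, hm⟩, -⟩
    · simp only [hd, Finset.sum_const_zero]
      have h3 : min τ (C * η + 1) ≤ min (τ + 1) (C * η + 1) := by gcongr; linarith
      have h4 : (1 - a) * ν * min τ (C * η + 1) ≤ (1 - a) * ν * min (τ + 1) (C * η + 1) := by
        have : 0 ≤ (1 - a) * ν := mul_nonneg (by linarith) (by linarith)
        gcongr
      have h5 : a * s (!c) ≤ a * 1 := by gcongr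
      linarith
    · have h3 := h.time_le R hfill hC hM hm
      rw [min_eq_left (by linarith)] at h1 ⊢
      rw [hs0]
      have h4 : (1 - a) * ∑ j, d (!c) j ≤ (1 - a) * ν := by gcongr
      linarith

end HalfCycle

/-! ### Growth, duration and restart of half a cycle -/

section Cycle

variable {J : ℕ} {ν a η : ℝ} {c : Bool} {Q Q' : Queue J → ℝ} {e : Bool → Fin J → ℝ}
  {M : Bool → Fin J → ℝ} {s : Bool → ℝ} {d : Bool → Fin J → ℝ} {n W t C τ Y G : ℝ}

/-- The invariant of half a cycle. -/
def HalfCycle (ν a η n W C : ℝ) (c : Bool) (t : ℝ) (Q : Queue J → ℝ)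
    (M : Bool → Fin J → ℝ) : Prop :=
  FirstPhase ν a η n W c t Q M ∨ ∃ τ Y G, SecondPhase ν a η n W C c t Q M τ Y G

/-- A linear functional of the contents of component `c`, conserved by the fluid dynamics during the
first phase. -/
def cycleWeight (a : ℝ) (c : Bool) (Q : Queue J → ℝ) : ℝ :=
  a * Q (c, none) + (1 - a) * ∑ j, Q (c, some j)

/-- The growth factor of the fluid dynamics in half a cycle. -/
def growth (J : ℕ) (ν a : ℝ) : ℝ := a / (a * ν / J + 1 - a)

/-- The bound on the duration of the services of the queues `j ≥ 1` of the filling component in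
the second phase, in units of the fluctuations. -/
def mixTime (J : ℕ) (ν a : ℝ) : ℝ :=
  ν * (9 * ν + 6 * J + 5) / (ν * (1 - a) * J / (J + ν ^ 2) - 1 - ν * a / J)

/-- The loss of weight in half a cycle, in units of the fluctuations. -/
def lossRate (J : ℕ) (ν a : ℝ) : ℝ :=
  growth J ν a * (8 * ν + 2 * J + 1) + 2 * J + 1 + ν * (mixTime J ν a + 1)

lemma mixTime_nonneg (R : Regime J ν a η)
    (hfill : 1 + ν * a / J < ν * (1 - a) * J / (J + ν ^ 2)) : 0 ≤ mixTime J ν a := by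
  have := R.ν_one
  have := R.J_one
  have : 0 < ν * (1 - a) * J / (J + ν ^ 2) - 1 - ν * a / J := by linarith
  unfold mixTime
  positivity

lemma growth_pos (R : Regime J ν a η) : 0 < a * ν / J + 1 - a ∧ 0 < growth J ν a := by
  have h1 := R.ν_one
  have h2 := R.J_one
  have h3 := R.a_pos
  have h4 := R.a_lt
  have h5 : 0 < a * ν / J + 1 - a := by
    have : 0 < a * ν / J := by positivity
    linarith
  exact ⟨h5, div_pos h3 h5⟩

lemma HalfCycle.step (R : Regime J ν a η)
    (hfill : 1 + ν * a / J < ν * (1 - a) * J / (J + ν ^ 2))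
    (S : Slot J ν Q Q' e s d) (hM : ∀ c j, |M c j| ≤ η) (hQ : ∀ k, 0 ≤ Q k)
    (hc : ¬ Drained ν c Q) (h : HalfCycle ν a η n W (mixTime J ν a) c t Q M) :
    HalfCycle ν a η n W (mixTime J ν a) c (t + 1) Q' (nextNoise J a M e) := by
  rcases h with h | ⟨τ, Y, G, h⟩
  · rcases S.work R.ν_one c hc with ⟨hd, hs, -⟩ | ⟨-, -, m, hm⟩
    · exact Or.inl (h.step R S hM hQ hd hs)
    -- The slot in which the priority changes is already the first slot of the second phase.
    · exact Or.inr ⟨_, _, _, (h.second R hM hQ (mixTime_nonneg R hfill) hm).step R hfill rfl S hM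
        hQ hc⟩
  · exact Or.inr ⟨_, _, _, h.step R hfill rfl S hM hQ hc⟩

/-- In the second phase, the weight of the filling component and the jobs of the other component
together exceed the initial weight. -/
lemma SecondPhase.weight_ge (R : Regime J ν a η)
    (hfill : 1 + ν * a / J < ν * (1 - a) * J / (J + ν ^ 2)) (hM : ∀ c j, |M c j| ≤ η)
    (h : SecondPhase ν a η n W (mixTime J ν a) c t Q M τ Y G) :
    growth J ν a * n - (lossRate J ν a - 1) * η ≤
      cycleWeight a (!c) Q + a * ∑ j, Q (c, some j) := by
  obtain ⟨hη1, hην, hη2, hηJ⟩ := R.η_bounds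
  obtain ⟨hg, hg0⟩ := growth_pos R
  have ha := R.a_pos
  have ha1 := R.a_lt
  have hJ := R.J_one
  have hν := R.ν_one
  have hC := mixTime_nonneg R hfill
  have h1 := h.size
  have h2 := h.weight
  have h3 := (abs_le.1 (abs_sum_le_of_abs_le (hM c))).1
  have h4 := (abs_le.1 (abs_sum_le_of_abs_le (hM (!c)))).1
  have h5 : growth J ν a * n ≤ a * Y + growth J ν a * ((8 * ν + 2 * J + 1) * η) := by
    have h6 : growth J ν a * ((a * ν / J + 1 - a) * Y) = a * Y := by
      rw [growth, ← mul_assoc, div_mul_cancel₀ _ hg.ne']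
    rw [← h6, ← mul_add]
    gcongr
  have h7 : (1 - a) * ν * min τ (mixTime J ν a * η + 1) ≤
      1 * ν * ((mixTime J ν a + 1) * η) := by
    have h8 : (1 - a) * ν * min τ (mixTime J ν a * η + 1) ≤
        (1 - a) * ν * ((mixTime J ν a + 1) * η) := by
      have : 0 ≤ (1 - a) * ν := mul_nonneg (by linarith) (by linarith)
      gcongr
      exact (min_le_right _ _).trans (by linarith)
    refine h8.trans ?_
    gcongr
    linarith
  have h9 : a * (-(J * η)) ≤ a * ∑ j, M c j := by gcongr
  have h10 : (1 - a) * (-(J * η)) ≤ (1 - a) * ∑ j, M (!c) j := by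
    gcongr
  rw [cycleWeight, lossRate]
  linarith

/-- The `5 * η` is the invariant `3 * η` plus `2 * η` for discarding the fluctuations, which restart
from zero. The jobs left in the drained component cost the last `η` of `lossRate`. -/
lemma HalfCycle.finish (R : Regime J ν a η)
    (hfill : 1 + ν * a / J < ν * (1 - a) * J / (J + ν ^ 2)) (hM : ∀ c j, |M c j| ≤ η)
    (hn : (4 * J + 4) * η < n) (hc : Drained ν c Q)
    (h : HalfCycle ν a η n W (mixTime J ν a) c t Q M) :
    growth J ν a * n - lossRate J ν a * η ≤ cycleWeight a (!c) Q ∧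
      ∀ i j, Q (!c, some i) - Q (!c, some j) ≤ 5 * η := by
  obtain ⟨-, -, -, hηJ⟩ := R.η_bounds
  rcases h with h | ⟨τ, Y, G, h⟩
  · exact absurd hc (h.not_drained R hM hn)
  · constructor
    · have h1 := h.weight_ge R hfill hM
      have h2 := sum_le_card_mul hc.2
      have h3 : a * ∑ j, Q (c, some j) ≤ 1 * η := by
        have := R.a_pos
        have := R.a_lt
        have := R.η_bounds.1
        calc a * ∑ j, Q (c, some j) ≤ a * η := by gcongr; linarith
          _ ≤ 1 * η := by gcongr
      linarith
    · intro i j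
      have h1 := h.even_other i j
      have h2 := abs_le.1 (hM (!c) i)
      have h3 := abs_le.1 (hM (!c) j)
      linarith

lemma cycleWeight_le_sum (ha : 0 ≤ a) (ha1 : a ≤ 1) (hQ : ∀ k, 0 ≤ Q k) (c : Bool) :
    cycleWeight a c Q + a * ∑ j, Q (!c, some j) ≤ ∑ k, Q k := by
  have h1 : ∑ k, Q k = (Q (c, none) + ∑ j, Q (c, some j))
      + (Q (!c, none) + ∑ j, Q (!c, some j)) := by
    rw [Fintype.sum_prod_type, Fintype.sum_bool, Fintype.sum_option, Fintype.sum_option]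
    cases c
    · simp only [Bool.not_false]; ring
    · simp only [Bool.not_true]
  have h2 : 0 ≤ ∑ j, Q (c, some j) := Finset.sum_nonneg fun j _ => hQ _
  have h3 : 0 ≤ ∑ j, Q (!c, some j) := Finset.sum_nonneg fun j _ => hQ _
  have h4 := hQ (c, none)
  have h5 := hQ (!c, none)
  rw [h1, cycleWeight]
  nlinarith

/-- This keeps the chain away from a fixed small state during the whole half cycle. -/
lemma HalfCycle.sum_ge (R : Regime J ν a η)
    (hfill : 1 + ν * a / J < ν * (1 - a) * J / (J + ν ^ 2)) (hM : ∀ c j, |M c j| ≤ η)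
    (hQ : ∀ k, 0 ≤ Q k) (hn : n ≤ growth J ν a * n - lossRate J ν a * η)
    (h : HalfCycle ν a η n W (mixTime J ν a) c t Q M) : n - J * η ≤ ∑ k, Q k := by
  have ha := R.a_pos
  have ha1 := R.a_lt
  have hη := R.η_bounds.1
  have hJ := R.J_one
  rcases h with h | ⟨τ, Y, G, h⟩
  · have h1 := h.weight
    have h2 := cycleWeight_le_sum ha.le ha1.le hQ c
    have h3 := (abs_le.1 (abs_sum_le_of_abs_le (hM c))).1
    have h4 := (abs_le.1 (abs_sum_le_of_abs_le (hM (!c)))).1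
    rw [cycleWeight] at h2
    nlinarith
  · have h1 := h.weight_ge R hfill hM
    have h2 := cycleWeight_le_sum ha.le ha1.le hQ (!c)
    rw [Bool.not_not] at h2
    have : 0 ≤ J * η := by positivity
    linarith

/-- The workload starts below `W`, falls at a constant rate, and cannot become negative except by
fluctuations. -/
lemma HalfCycle.time_le (R : Regime J ν a η) (hM : ∀ c j, |M c j| ≤ η) (hQ : ∀ k, 0 ≤ Q k)
    (h : HalfCycle ν a η n W C c t Q M) : (1 - a - a / ν) * t ≤ W + 2 * J * η := by
  have hν := R.ν_one
  have h1 := (abs_le.1 (abs_sum_le_of_abs_le (hM c))).2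
  have h2 := (abs_le.1 (abs_sum_le_of_abs_le (hM (!c)))).2
  have h3 := hQ (c, none)
  have h4 : 0 ≤ ∑ j, Q (c, some j) := Finset.sum_nonneg fun j _ => hQ _
  have h5 : 0 ≤ ∑ j, Q (!c, some j) := Finset.sum_nonneg fun j _ => hQ _
  have h6 : -(J * η) ≤ (∑ j, Q (c, some j) - ∑ j, M c j) / ν := by
    rw [le_div_iff₀ (by linarith)]
    have : (0 : ℝ) ≤ J * η := mul_nonneg (Nat.cast_nonneg J) (by linarith [R.η_bounds.1])
    nlinarith
  rcases h with h | ⟨τ, Y, G, h⟩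
  · linarith [h.work]
  · linarith [h.work, h.work_start]

/-- The states at the beginning of half a cycle. -/
structure CycleStart (ν a ε n₀ : ℝ) (c : Bool) (Q : Queue J → ℝ) : Prop where
  drained : Drained ν (!c) Q
  even : ∀ i j, Q (c, some i) - Q (c, some j) ≤ 5 * (ε * cycleWeight a c Q)
  weight_ge : n₀ ≤ cycleWeight a c Q

/-- For weight n, queue 0 holds at most n/a jobs, the other queues of `c` at most n/(1 - a), and
those of the drained component at most n; hence the initial workload. -/
lemma CycleStart.halfCycle {ε n₀ : ℝ} (hε : ε ≤ 1)
    (hQ : ∀ k, 0 ≤ Q k) (h : CycleStart ν a ε n₀ c Q) (R : Regime J ν a (ε * cycleWeight a c Q)) :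
    HalfCycle ν a (ε * cycleWeight a c Q) (cycleWeight a c Q) ((1 / a + 1 / (1 - a) + 1) * cycleWeight a c Q) C c 0
      Q (fun _ _ => 0) := by
  obtain ⟨hη1, hην, hη2, hηJ⟩ := R.η_bounds
  have ha := R.a_pos
  have ha1 : 0 < 1 - a := by linarith [R.a_lt]
  have hJ := R.J_one
  have hν := R.ν_one
  have hx := hQ (c, none)
  have hy : 0 ≤ ∑ j, Q (c, some j) := Finset.sum_nonneg fun j _ => hQ _
  have hv : 0 ≤ ∑ j, Q (!c, some j) := Finset.sum_nonneg fun j _ => hQ _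
  have hv' := sum_le_card_mul h.drained.2
  set w := cycleWeight a c Q with hw
  have hw' : w = a * Q (c, none) + (1 - a) * ∑ j, Q (c, some j) := hw
  have h1 : Q (c, none) ≤ 1 / a * w := by
    rw [div_mul_eq_mul_div, le_div_iff₀ ha]
    nlinarith
  have h2 : ∑ j, Q (c, some j) ≤ 1 / (1 - a) * w := by
    rw [div_mul_eq_mul_div, le_div_iff₀ ha1]
    nlinarith
  have h3 : ε * w ≤ w := by
    have : 0 ≤ w := by rw [hw']; positivity
    nlinarith
  have h4 : (∑ j, Q (c, some j)) / ν ≤ ∑ j, Q (c, some j) := div_le_self hy hν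
  refine Or.inl ⟨?_, ?_, ?_, ?_, ?_, ?_⟩
  · simpa using h.even
  · intro i j
    have := h.drained.2 i
    have := hQ (!c, some j)
    simp only [sub_zero]
    linarith
  · simp only [Finset.sum_const_zero, sub_zero]
    have := mul_nonneg ha.le hv
    linarith
  · exact h.drained.1.trans hη2
  · simp only [Finset.sum_const_zero, sub_zero]
    have : (0 : ℝ) ≤ 2 * J * (ε * w) := by positivity
    linarith
  · simp only [Finset.sum_const_zero, sub_zero, mul_zero, add_zero]
    linarith

end Cycle

/-! ### Probability that the fluctuations ever spoil the cycles -/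

section Escape

variable {J : ℕ} {a : ℝ}

/-- The sum of the squares of the fluctuations. -/
def noiseEnergy (M : Bool → Fin J → ℝ) : ℝ := ∑ c, ∑ j, M c j ^ 2

lemma sq_le_noiseEnergy (M : Bool → Fin J → ℝ) (c : Bool) (j : Fin J) :
    M c j ^ 2 ≤ noiseEnergy M :=
  (Finset.single_le_sum (f := fun j => M c j ^ 2) (fun _ _ => sq_nonneg _)
    (Finset.mem_univ j)).trans (Finset.single_le_sum (f := fun c => ∑ j, M c j ^ 2)
      (fun _ _ => Finset.sum_nonneg fun _ _ => sq_nonneg _) (Finset.mem_univ c))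

lemma noiseEnergy_nonneg (M : Bool → Fin J → ℝ) : 0 ≤ noiseEnergy M :=
  Finset.sum_nonneg fun _ _ => Finset.sum_nonneg fun _ _ => sq_nonneg _

lemma pmfExp_noiseEnergy_le (h0 : 0 ≤ a / J) (h1 : a / J ≤ 1) (M : Bool → Fin J → ℝ) {A B : ℝ}
    (hA : 0 ≤ A) (hB : 0 ≤ B) :
    pmfExp (jointLaw (twoComponentArrivals J a).law) (fun e =>
      ENNReal.ofReal (A * noiseEnergy (nextNoise J a M fun c j => e (c, some j)) + B)) ≤
      ENNReal.ofReal (A * (noiseEnergy M + 2 * J) + B) := by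
  have hsum : ∀ N : Bool → Fin J → ℝ, ENNReal.ofReal (A * noiseEnergy N + B) =
      ∑ c, ∑ j, ENNReal.ofReal A * ENNReal.ofReal (N c j ^ 2) + ENNReal.ofReal B := by
    intro N
    rw [ENNReal.ofReal_add (mul_nonneg hA (noiseEnergy_nonneg N)) hB, ENNReal.ofReal_mul hA,
      noiseEnergy, ENNReal.ofReal_sum_of_nonneg
        fun _ _ => Finset.sum_nonneg fun _ _ => sq_nonneg _, Finset.mul_sum]
    congr 1
    refine Finset.sum_congr rfl fun c _ => ?_
    rw [ENNReal.ofReal_sum_of_nonneg fun _ _ => sq_nonneg _, Finset.mul_sum]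
  have hE : noiseEnergy M + 2 * J = ∑ c : Bool, ∑ j, (M c j ^ 2 + 1) := by
    simp only [Finset.sum_add_distrib, noiseEnergy]
    simp
  simp only [hsum]
  rw [pmfExp_add, pmfExp_const, pmfExp_sum, hE, ENNReal.ofReal_add
    (mul_nonneg hA (Finset.sum_nonneg fun _ _ => Finset.sum_nonneg fun _ _ => by positivity)) hB,
    ENNReal.ofReal_mul hA, ENNReal.ofReal_sum_of_nonneg
      fun _ _ => Finset.sum_nonneg fun _ _ => by positivity, Finset.mul_sum]
  gcongr with c
  rw [pmfExp_sum, ENNReal.ofReal_sum_of_nonneg fun _ _ => by positivity, Finset.mul_sum]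
  gcongr with j
  have := pmfExp_sq_arrival_le h0 h1 (M c j) c j
  calc _ = ENNReal.ofReal A * pmfExp (jointLaw (twoComponentArrivals J a).law)
        (fun e => ENNReal.ofReal ((M c j + e (c, some j) - a / J) ^ 2)) := by
        simp only [pmfExp, ← ENNReal.tsum_mul_left]
        exact tsum_congr fun e => mul_left_comm _ _ _
    _ ≤ _ := by gcongr

/-- Queue lengths as real numbers. -/
def realQ (Q : Queue J → ℕ) : Queue J → ℝ := fun k => Q k

lemma realQ_nonneg (Q : Queue J → ℕ) (k : Queue J) : 0 ≤ realQ Q k := Nat.cast_nonneg _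

/-- Assumptions on the relative size `ε` of the fluctuations, the minimal initial weight `n₀`, the
growth rate `g`, and the duration `T` of half a cycle for initial weight one. -/
structure Scales (J ν : ℕ) (a ε n₀ g T : ℝ) (x₀ : Queue J → ℕ) : Prop where
  regime : ∀ n, n₀ ≤ n → Regime J ν a (ε * n)
  filling : 1 + ν * a / J < (ν : ℝ) * (1 - a) * J / (J + (ν : ℝ) ^ 2)
  ε_pos : 0 < ε
  ε_small : (4 * J + 4) * ε < 1
  g_one : 1 < g
  g_le : g ≤ growth J ν a - lossRate J ν a * ε
  one_le : 1 ≤ n₀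
  state_lt : ∑ k, realQ x₀ k < n₀ / 2
  time : 1 / a + 1 / (1 - a) + 2 ≤ (T - 1) * (1 - a - a / ν)

variable {ν : ℕ} {ε n₀ g T : ℝ} {x₀ : Queue J → ℕ}

/-- The bound on the probability of ever visiting `x₀`, times the initial weight. -/
def escapeConst (J : ℕ) (ε g T : ℝ) : ℝ := 2 * J * T / ε ^ 2 * (g / (g - 1))

lemma Scales.T_pos (H : Scales J ν a ε n₀ g T x₀) : 1 ≤ T := by
  have R := H.regime n₀ le_rfl
  have ha := R.a_pos
  have ha1 : 0 < 1 - a := by linarith [R.a_lt]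
  have h := H.time
  have h1 : 0 < 1 / a + 1 / (1 - a) + 2 := by positivity
  have h2 : 0 < 1 - a - a / ν := by linarith [R.load]
  by_contra hT
  nlinarith

lemma Scales.escapeConst_nonneg (H : Scales J ν a ε n₀ g T x₀) : 0 ≤ escapeConst J ε g T := by
  have h1 := H.T_pos
  have h2 := H.g_one
  have h3 : 0 < g - 1 := by linarith
  unfold escapeConst
  positivity

/-- The Chebyshev cost of one half cycle plus the bound at the next start, of weight at least `g *
n`, gives back the bound at weight `n`. The factor `g / (g - 1)` sums the geometric series of costs.
-/
lemma Scales.escapeConst_eq (H : Scales J ν a ε n₀ g T x₀) {n : ℝ} (hn : 0 < n) :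
    1 / (ε * n) ^ 2 * (2 * J * (T * n)) + escapeConst J ε g T / (g * n) =
      escapeConst J ε g T / n := by
  have h2 := H.g_one
  have h3 : g - 1 ≠ 0 := by linarith
  have h4 := H.ε_pos
  unfold escapeConst
  field_simp
  ring

/-- The bound on the probability of ever visiting `x₀` in the course of half a cycle. -/
def escapeBound (J : ℕ) (ε g T n t : ℝ) (M : Bool → Fin J → ℝ) : ℝ :=
  1 / (ε * n) ^ 2 * noiseEnergy M
    + (1 / (ε * n) ^ 2 * (2 * J * (T * n - t)) + escapeConst J ε g T / (g * n))

lemma Scales.halfCycle_facts (H : Scales J ν a ε n₀ g T x₀) {n t : ℝ} (hn : n₀ ≤ n) {c : Bool}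
    {Q : Queue J → ℕ} {M : Bool → Fin J → ℝ} (hM : ∀ c j, |M c j| ≤ ε * n)
    (h : HalfCycle ν a (ε * n) n ((1 / a + 1 / (1 - a) + 1) * n) (mixTime J ν a) c t (realQ Q) M) :
    Q ≠ x₀ ∧ t + 1 ≤ T * n ∧ (Drained ν c (realQ Q) → CycleStart ν a ε n₀ (!c) (realQ Q) ∧
      g * n ≤ cycleWeight a (!c) (realQ Q)) := by
  have R := H.regime n hn
  have hn1 : 1 ≤ n := H.one_le.trans hn
  have hJ := R.J_one
  have hg : g * n ≤ growth J ν a * n - lossRate J ν a * (ε * n) := by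
    have := mul_le_mul_of_nonneg_right H.g_le (by linarith : 0 ≤ n)
    linarith
  have hgn : n ≤ g * n := by nlinarith [H.g_one]
  have hη : (4 * J + 4) * (ε * n) < n := by nlinarith [H.ε_small]
  have hη0 : 0 ≤ ε * n := by linarith [R.η_bounds.1]
  refine ⟨?_, ?_, fun hd => ?_⟩
  · rintro rfl
    have h1 := h.sum_ge R H.filling hM (realQ_nonneg Q) (by linarith)
    have h2 := H.state_lt
    nlinarith
  · have h1 := h.time_le R hM (realQ_nonneg Q)
    have h2 : 0 < 1 - a - a / ν := by linarith [R.load]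
    have h3 := H.time
    have h4 : (1 - a - a / ν) * t ≤ (1 - a - a / ν) * ((T - 1) * n) := by
      have : (1 / a + 1 / (1 - a) + 2) * n ≤ (T - 1) * (1 - a - a / ν) * n := by gcongr
      nlinarith
    have := le_of_mul_le_mul_left h4 h2
    linarith
  · obtain ⟨h1, h2⟩ := h.finish R H.filling hM hη hd
    have h3 : n ≤ cycleWeight a (!c) (realQ Q) := by linarith
    refine ⟨⟨by rwa [Bool.not_not], fun i j => (h2 i j).trans ?_, hn.trans h3⟩, hg.trans h1⟩
    have := H.ε_pos
    gcongr

variable {pol : (Queue J → ℕ) → PMF (Queue J → ℕ)}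

/-- The half cycle estimate at `k` is taken as a hypothesis, so that the induction on `k` can call
this lemma whenever a half cycle ends. -/
lemma hitWithin_le_of_cycleStart (H : Scales J ν a ε n₀ g T x₀) (k : ℕ)
    (hk : ∀ (c : Bool) (n t : ℝ) (Q : Queue J → ℕ) (M : Bool → Fin J → ℝ), n₀ ≤ n →
      (∀ c j, |M c j| ≤ ε * n) → ¬ Drained ν c (realQ Q) →
      HalfCycle ν a (ε * n) n ((1 / a + 1 / (1 - a) + 1) * n) (mixTime J ν a) c t (realQ Q) M →
      hitWithin ((twoComponent J ν).step (twoComponentArrivals J a) pol) x₀ k Q ≤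
        ENNReal.ofReal (escapeBound J ε g T n t M))
    {c : Bool} {z : Queue J → ℕ} (hz : CycleStart ν a ε n₀ c (realQ z)) :
    hitWithin ((twoComponent J ν).step (twoComponentArrivals J a) pol) x₀ k z ≤
      ENNReal.ofReal (escapeConst J ε g T / cycleWeight a c (realQ z)) := by
  set n := cycleWeight a c (realQ z) with hn
  have R := H.regime n hz.weight_ge
  have hn1 : 1 ≤ n := H.one_le.trans hz.weight_ge
  have hJ := R.J_one
  have hη : (4 * J + 4) * (ε * n) < n := by nlinarith [H.ε_small]
  have hM : ∀ (c : Bool) (j : Fin J), |(fun _ _ => 0 : Bool → Fin J → ℝ) c j| ≤ ε * n := by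
    intro _ _
    simp only [abs_zero]
    linarith [R.η_bounds.1]
  have hε1 : ε ≤ 1 := by nlinarith [H.ε_small, H.ε_pos]
  have h := hz.halfCycle (C := mixTime J ν a) hε1 (realQ_nonneg z) R
  have hnd : ¬ Drained ν c (realQ z) := by
    intro hd
    have h1 := sum_le_card_mul hd.2
    have h2 := hd.1
    have h3 := R.η_bounds
    have h4 := R.a_pos
    have h5 := R.a_lt
    have h6 : n = a * realQ z (c, none) + (1 - a) * ∑ j, realQ z (c, some j) := hn
    have h7 : a * realQ z (c, none) ≤ a * (ε * n) := by gcongr; linarith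
    have h8 : (1 - a) * ∑ j, realQ z (c, some j) ≤ (1 - a) * (ε * n) := by
      gcongr
      linarith
    nlinarith
  refine (hk c n 0 z _ hz.weight_ge hM hnd h).trans (le_of_eq ?_)
  rw [escapeBound, ← H.escapeConst_eq (by linarith : 0 < n)]
  simp [noiseEnergy]

/-- `escapeBound` is a supermartingale: the energy gains at most `2 * J` per slot in mean, paid by
the countdown `T * n - t`. If the fluctuations exceed `ε * n`, the energy term alone is at least 1.
If `c` is drained, the next half cycle takes over. Otherwise the invariant continues. -/
lemma hitWithin_le_of_halfCycle (H : Scales J ν a ε n₀ g T x₀) (hν : 1 < ν) (hJ : ν < J)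
    (hpol : (twoComponent J ν).IsMaxWeight pol) (k : ℕ) :
    ∀ (c : Bool) (n t : ℝ) (Q : Queue J → ℕ) (M : Bool → Fin J → ℝ), n₀ ≤ n →
      (∀ c j, |M c j| ≤ ε * n) → ¬ Drained ν c (realQ Q) →
      HalfCycle ν a (ε * n) n ((1 / a + 1 / (1 - a) + 1) * n) (mixTime J ν a) c t (realQ Q) M →
      hitWithin ((twoComponent J ν).step (twoComponentArrivals J a) pol) x₀ k Q ≤
        ENNReal.ofReal (escapeBound J ε g T n t M) := by
  induction k with
  | zero => intros; simp [hitWithin]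
  | succ k ih =>
    intro c n t Q M hn hM hnd h
    have R := H.regime n hn
    have hn1 : 1 ≤ n := H.one_le.trans hn
    have hη1 := R.η_bounds.1
    have hg := H.g_one
    have hK := H.escapeConst_nonneg
    have hJ1 := R.J_one
    have hp0 : 0 ≤ a / J := div_nonneg R.a_pos.le (by linarith)
    have hp1 : a / J ≤ 1 := by
      rw [div_le_one (by linarith)]
      linarith [R.a_lt]
    have htime := (H.halfCycle_facts hn hM h).2.1
    have hB : 0 ≤ 1 / (ε * n) ^ 2 * (2 * J * (T * n - (t + 1))) + escapeConst J ε g T / (g * n) := by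
      have h1 : 0 ≤ T * n - (t + 1) := by linarith
      positivity
    rw [hitWithin, pmfExp_step_twoComponent, ← pmfExp_const (pol Q)
      (ENNReal.ofReal (escapeBound J ε g T n t M))]
    refine pmfExp_mono fun σ hσ => ?_
    have hσ' : MaximizesWeight ν Q σ := hpol Q σ hσ
    calc _ ≤ pmfExp (jointLaw (twoComponentArrivals J a).law) (fun e => ENNReal.ofReal
          (1 / (ε * n) ^ 2 * noiseEnergy (nextNoise J a M fun c j => e (c, some j)) +
          (1 / (ε * n) ^ 2 * (2 * J * (T * n - (t + 1))) + escapeConst J ε g T / (g * n)))) := by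
          refine pmfExp_mono fun e he => ?_
          set M' := nextNoise J a M fun c j => (e (c, some j) : ℝ) with hM'
          by_cases hM1 : ∀ c j, |M' c j| ≤ ε * n
          · have S : Slot J ν (realQ Q) (realQ (nextState Q σ e)) (fun c j => e (c, some j)) _ _ :=
              hσ'.slot (by omega) (by omega) (arrivals_none he)
            have h' := h.step R H.filling S hM (realQ_nonneg Q) hnd
            obtain ⟨h1, h2, h3⟩ := H.halfCycle_facts hn hM1 h'
            rw [if_neg h1]
            by_cases hd : Drained ν c (realQ (nextState Q σ e))
            · obtain ⟨h4, h5⟩ := h3 hd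
              refine (hitWithin_le_of_cycleStart H k ih h4).trans (ENNReal.ofReal_le_ofReal ?_)
              have h6 : escapeConst J ε g T / cycleWeight a (!c) (realQ (nextState Q σ e)) ≤
                  escapeConst J ε g T / (g * n) := by
                gcongr
              have h7 : 0 ≤ T * n - (t + 1) := by linarith
              have h8 := noiseEnergy_nonneg M'
              have h9 : 0 ≤ 1 / (ε * n) ^ 2 * noiseEnergy M' := by positivity
              have h10 : 0 ≤ 1 / (ε * n) ^ 2 * (2 * J * (T * n - (t + 1))) := by positivity
              linarith
            · exact ih c n (t + 1) _ M' hn hM1 hd h'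
          · push Not at hM1
            obtain ⟨c', j, hcj⟩ := hM1
            refine le_trans (b := 1) ?_ ?_
            · split_ifs
              exacts [le_rfl, hitWithin_le_one _ _ _ _]
            rw [← ENNReal.ofReal_one]
            refine ENNReal.ofReal_le_ofReal ?_
            have h2 : (ε * n) ^ 2 ≤ noiseEnergy M' := by
              refine le_trans ?_ (sq_le_noiseEnergy M' c' j)
              rw [← sq_abs (M' c' j)]
              gcongr
            have h3 : 1 ≤ 1 / (ε * n) ^ 2 * noiseEnergy M' := by
              rw [div_mul_eq_mul_div, one_mul, one_le_div (by positivity)]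
              exact h2
            linarith
      _ ≤ ENNReal.ofReal (1 / (ε * n) ^ 2 * (noiseEnergy M + 2 * J) +
          (1 / (ε * n) ^ 2 * (2 * J * (T * n - (t + 1))) + escapeConst J ε g T / (g * n))) :=
          pmfExp_noiseEnergy_le hp0 hp1 M (by positivity) hB
      _ = _ := by
          congr 1
          rw [escapeBound]
          ring

/-- From the beginning of a cycle with large weight, `x₀` is never visited with high
probability. -/
theorem hitWithin_le (H : Scales J ν a ε n₀ g T x₀) (hν : 1 < ν) (hJ : ν < J)
    (hpol : (twoComponent J ν).IsMaxWeight pol) (k : ℕ) {c : Bool} {z : Queue J → ℕ}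
    (hz : CycleStart ν a ε n₀ c (realQ z)) :
    hitWithin ((twoComponent J ν).step (twoComponentArrivals J a) pol) x₀ k z ≤
      ENNReal.ofReal (escapeConst J ε g T / cycleWeight a c (realQ z)) :=
  hitWithin_le_of_cycleStart H k (hitWithin_le_of_halfCycle H hν hJ hpol k) hz

end Escape

/-! ### Reaching the beginning of a cycle -/

section Reach

variable {J ν : ℕ} {a : ℝ} {pol : (Queue J → ℕ) → PMF (Queue J → ℕ)}

lemma exists_slot (hJ : 0 < J) (hν : 0 < ν) (h0 : 0 < a / J) (h1 : a / J < 1)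
    (hpol : (twoComponent J ν).IsMaxWeight pol) (Q : Queue J → ℕ) (e : Bool → Fin J → ℕ)
    (he : ∀ c j, e c j ≤ 1) :
    ∃ Q' ∈ ((twoComponent J ν).step (twoComponentArrivals J a) pol Q).support, ∃ s d,
      Slot J ν (realQ Q) (realQ Q') (fun c j => (e c j : ℝ)) s d := by
  obtain ⟨σ, hσ⟩ := (pol Q).support_nonempty
  let e' : Queue J → ℕ := fun k => k.2.elim 0 (e k.1)
  have he' : e' ∈ (jointLaw (twoComponentArrivals J a).law).support :=
    mem_support_arrivals h0 h1 (fun _ => rfl) he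
  have hmax : MaximizesWeight ν Q σ := hpol Q σ hσ
  exact ⟨_, nextState_mem_support hσ he', _, _, hmax.slot hJ hν (e := e') fun _ => rfl⟩

lemma Slot.sum_d_le {ν : ℝ} {Q Q' : Queue J → ℝ} {e d : Bool → Fin J → ℝ} {s : Bool → ℝ}
    (S : Slot J ν Q Q' e s d) (hν : 0 ≤ ν) (c : Bool) : ∑ j, d c j ≤ ν ∧ s c ≤ 1 := by
  rcases S.mode c with ⟨h1, h2, -⟩ | ⟨h1, h2, -⟩
  · exact ⟨by simpa [h1] using hν, h2⟩
  · exact ⟨h2, by linarith⟩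

/-- Let one job arrive at each 𝒜_j and none at ℬ_j in every slot. Since `J > ν`, the total over the
𝒜_j rises by at least one, while transfers from ℬ_j to 𝒜_0 preserve the sum that must not grow. -/
lemma exists_reachable_filled (hν : 0 < ν) (hJ : ν < J) (h0 : 0 < a / J) (h1 : a / J < 1)
    (hpol : (twoComponent J ν).IsMaxWeight pol) (x : Queue J → ℕ) (N : ℕ) :
    ∃ z, Relation.ReflTransGen (fun y w => w ∈
        ((twoComponent J ν).step (twoComponentArrivals J a) pol y).support) x z ∧
      realQ z (true, none) + ∑ j, realQ z (false, some j) ≤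
        realQ x (true, none) + ∑ j, realQ x (false, some j) ∧
      (N : ℝ) ≤ ∑ j, realQ z (true, some j) := by
  induction N with
  | zero => exact ⟨x, .refl, le_rfl, by
      simpa using Finset.sum_nonneg fun j _ => realQ_nonneg x (true, some j)⟩
  | succ N ih =>
    obtain ⟨z, hz, hz1, hz2⟩ := ih
    obtain ⟨z', hz', s, d, S⟩ := exists_slot (by omega) hν h0 h1 hpol z
      (fun c _ => if c then 1 else 0) (by intro c j; split_ifs <;> simp)
    refine ⟨z', hz.tail hz', ?_, ?_⟩
    · have h2 := S.none_eq true
      have h3 := S.sum_some false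
      simp only [Bool.not_true, Bool.false_eq_true, if_false, Nat.cast_zero,
        Finset.sum_const_zero] at h2 h3
      linarith [S.s_nonneg true]
    · have h3 := S.sum_some true
      simp only [if_true, Nat.cast_one, Finset.sum_const, Finset.card_univ, Fintype.card_fin,
        nsmul_eq_mul, mul_one] at h3
      have h4 := (S.sum_d_le (Nat.cast_nonneg ν) true).1
      have h5 : (ν : ℝ) + 1 ≤ J := by exact_mod_cast hJ
      push_cast
      linarith

/-- Without arrivals, the functional bounded below by `B` cannot decrease while 𝒜 is not drained.
Serving 𝒜_0 gains `ν`, and serving the 𝒜_j gains `ν * ν - (ν - 1) * ν = ν`; in both cases ℬ_0 loses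
at most one job, which costs `ν`. -/
lemma exists_reachable_drained (hν : 0 < ν) (hJ : ν < J) (h0 : 0 < a / J) (h1 : a / J < 1)
    (hpol : (twoComponent J ν).IsMaxWeight pol) {X B : ℝ} (k : ℕ) (x : Queue J → ℕ)
    (hk : realQ x (true, none) + ∑ j, realQ x (false, some j) + ∑ j, realQ x (true, some j) ≤ k)
    (hX : realQ x (true, none) + ∑ j, realQ x (false, some j) ≤ X)
    (hB : B ≤ ν * realQ x (false, none) + (ν - 1) * ∑ j, realQ x (true, some j)
      - ν * (realQ x (true, none) + ∑ j, realQ x (false, some j))) :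
    ∃ z, Relation.ReflTransGen (fun y w => w ∈
        ((twoComponent J ν).step (twoComponentArrivals J a) pol y).support) x z ∧
      Drained ν true (realQ z) ∧
      realQ z (true, none) + ∑ j, realQ z (false, some j) ≤ X ∧
      B ≤ ν * realQ z (false, none) + (ν - 1) * ∑ j, realQ z (true, some j)
      - ν * (realQ z (true, none) + ∑ j, realQ z (false, some j)) := by
  have hν1 : (1 : ℝ) ≤ ν := by exact_mod_cast hν
  induction k generalizing x with
  | zero =>
    refine ⟨x, .refl, ?_, hX, hB⟩
    have h2 := realQ_nonneg x (true, none)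
    have h3 : 0 ≤ ∑ j, realQ x (false, some j) := Finset.sum_nonneg fun j _ => realQ_nonneg x _
    have h4 : 0 ≤ ∑ j, realQ x (true, some j) := Finset.sum_nonneg fun j _ => realQ_nonneg x _
    rw [Nat.cast_zero] at hk
    refine ⟨by nlinarith, fun j => ?_⟩
    have := sum_single_le (fun j => realQ x (true, some j)) (fun j => realQ_nonneg x _) j
    linarith
  | succ k ih =>
    by_cases hd : Drained ν true (realQ x)
    · exact ⟨x, .refl, hd, hX, hB⟩
    · obtain ⟨z, hz, s, d, S⟩ := exists_slot (by omega) hν h0 h1 hpol x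
        (fun _ _ => 0) (by simp)
      have h2 := S.none_eq true
      have h3 := S.sum_some false
      have h4 := S.none_eq false
      have h5 := S.sum_some true
      simp only [Bool.not_true, Bool.not_false, Nat.cast_zero, Finset.sum_const_zero,
        add_zero] at h2 h3 h4 h5
      have h6 := (S.sum_d_le (Nat.cast_nonneg ν) false).2
      push_cast at hk
      have hstep : ∀ y, Relation.ReflTransGen (fun y w => w ∈
          ((twoComponent J ν).step (twoComponentArrivals J a) pol y).support) z y →
          Relation.ReflTransGen (fun y w => w ∈
          ((twoComponent J ν).step (twoComponentArrivals J a) pol y).support) x y :=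
        fun y hy => .head hz hy
      have hss : (ν : ℝ) * s false ≤ ν * 1 := by gcongr
      rcases S.work hν1 true hd with ⟨h7, h8, -⟩ | ⟨h7, h8, -⟩
      · have h9 : ∑ j, d true j = 0 := by simp [h7]
        obtain ⟨y, hy, hy'⟩ := ih z (by linarith) (by linarith) (by
          rw [h2, h3, h4, h5, h8, h9]; linarith)
        exact ⟨y, hstep y hy, hy'⟩
      · obtain ⟨y, hy, hy'⟩ := ih z (by linarith) (by linarith) (by
          rw [h2, h3, h4, h5, h7, h8]; linarith)
        exact ⟨y, hstep y hy, hy'⟩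

lemma exists_reachable_cycleStart (hν : 1 < ν) (hJ : ν < J) (ha : 0 < a) (ha1 : a < 1)
    (hpol : (twoComponent J ν).IsMaxWeight pol) (x : Queue J → ℕ) {ε : ℝ} (hε : 0 < ε) (n₀ : ℝ) :
    ∃ z, Relation.ReflTransGen (fun y w => w ∈
        ((twoComponent J ν).step (twoComponentArrivals J a) pol y).support) x z ∧
      CycleStart ν a ε n₀ false (realQ z) := by
  have hJ1 : (1 : ℝ) ≤ J := by exact_mod_cast (by omega : 1 ≤ J)
  have hν2 : (2 : ℝ) ≤ ν := by exact_mod_cast hν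
  have h0 : 0 < a / J := by positivity
  have h1 : a / J < 1 := by rw [div_lt_one (by linarith)]; linarith
  set X := realQ x (true, none) + ∑ j, realQ x (false, some j) with hX
  -- After draining, the functional must leave enough jobs in ℬ_0. The first two terms pay for its
  -- other parts, and the maximum makes the weight exceed both `n₀` and the level at which `X` jobs
  -- count as even.
  obtain ⟨N, hN⟩ := exists_nat_ge
    (ν * X + (ν - 1) * (J * ν) + ν * (max n₀ (X / (5 * ε)) / a))
  obtain ⟨y, hy, hy1, hy2⟩ := exists_reachable_filled (by omega) hJ h0 h1 hpol x N
  obtain ⟨k, hk⟩ := exists_nat_ge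
    (realQ y (true, none) + ∑ j, realQ y (false, some j) + ∑ j, realQ y (true, some j))
  have h2 := realQ_nonneg y (false, none)
  obtain ⟨z, hz, hz1, hz2, hz3⟩ := exists_reachable_drained (by omega) hJ h0 h1 hpol
    (X := X) (B := N - ν * X) k y hk hy1 (by
      have h3 : (ν : ℝ) * (realQ y (true, none) + ∑ j, realQ y (false, some j)) ≤ ν * X := by
        gcongr
      have h4 : (N : ℝ) ≤ (ν - 1) * ∑ j, realQ y (true, some j) := by nlinarith
      have h5 : 0 ≤ ν * realQ y (false, none) := by positivity
      linarith)
  refine ⟨z, hy.trans hz, ?_⟩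
  have h3 : 0 ≤ ∑ j, realQ z (false, some j) := Finset.sum_nonneg fun j _ => realQ_nonneg z _
  have h4 := realQ_nonneg z (true, none)
  have h5 : (ν - 1 : ℝ) * ∑ j, realQ z (true, some j) ≤ (ν - 1) * (J * ν) := by
    gcongr
    · linarith
    · exact sum_le_card_mul hz1.2
  have h6 : (ν : ℝ) * (max n₀ (X / (5 * ε)) / a) ≤ ν * realQ z (false, none) := by
    have : 0 ≤ (ν : ℝ) * (realQ z (true, none) + ∑ j, realQ z (false, some j)) := by positivity
    linarith
  have h7 := le_of_mul_le_mul_left h6 (by linarith)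
  rw [div_le_iff₀ ha] at h7
  have h8 : max n₀ (X / (5 * ε)) ≤ cycleWeight a false (realQ z) := by
    have : 0 ≤ (1 - a) * ∑ j, realQ z (false, some j) := mul_nonneg (by linarith) h3
    rw [cycleWeight]
    linarith
  refine ⟨hz1, fun i j => ?_, (le_max_left _ _).trans h8⟩
  have h9 := (le_max_right _ _).trans h8
  rw [div_le_iff₀ (by positivity)] at h9
  have h10 := sum_single_le (fun j => realQ z (false, some j)) (fun j => realQ_nonneg z _) i
  have h11 := realQ_nonneg z (false, some j)
  linarith

end Reach

/-! ### Transience -/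

section Transience

variable {J ν : ℕ} {a : ℝ}

lemma exists_scales (hν : 1 < ν) (hJ : ν < J) (ha : a * (1 + 1 / (ν : ℝ)) < 1)
    (hl : (J : ℝ) / (2 * J - ν) < a)
    (hu : a < 1 - ((J : ℝ) + ν) * (J + (ν : ℝ) ^ 2) / (ν * ((J : ℝ) ^ 2 + J + (ν : ℝ) ^ 2)))
    (x₀ : Queue J → ℕ) :
    ∃ ε g T : ℝ, ∀ᶠ n₀ in Filter.atTop, Scales J ν a ε n₀ g T x₀ := by
  have hν2 : (2 : ℝ) ≤ ν := by exact_mod_cast hν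
  have hJν : (ν : ℝ) + 1 ≤ J := by exact_mod_cast hJ
  have hJ0 : (0 : ℝ) < J := by linarith
  have hden : 0 < 2 * (J : ℝ) - ν := by linarith
  have ha0 : 0 < a := lt_trans (by positivity) hl
  have hload : a + a / ν < 1 := by
    rw [mul_add, mul_one_div, mul_one] at ha
    exact ha
  have ha1 : a < 1 := by
    have : 0 < a / ν := by positivity
    linarith
  have hR : ∀ η, (J : ℝ) * (ν : ℝ) ^ 2 ≤ η → Regime J ν a η := fun η hη =>
    ⟨by linarith, by linarith, ha0, ha1, hload, hη⟩
  have hfill : 1 + ν * a / J < (ν : ℝ) * (1 - a) * J / (J + (ν : ℝ) ^ 2) := by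
    have h1 : ((J : ℝ) + ν) * (J + (ν : ℝ) ^ 2) / (ν * ((J : ℝ) ^ 2 + J + (ν : ℝ) ^ 2)) < 1 - a := by
      linarith
    rw [div_lt_iff₀ (by positivity)] at h1
    rw [lt_div_iff₀ (by positivity), ← sub_pos]
    -- After clearing denominators, `hu` is the filling condition.
    have h2 : (ν : ℝ) * (1 - a) * J - (1 + ν * a / J) * (J + (ν : ℝ) ^ 2) =
        ((1 - a) * (ν * ((J : ℝ) ^ 2 + J + (ν : ℝ) ^ 2)) - (J + ν) * (J + (ν : ℝ) ^ 2)) / J := by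
      field_simp
      ring
    rw [h2]
    exact div_pos (by linarith) (by linarith)
  have R₀ := hR _ le_rfl
  obtain ⟨hg0, hg1⟩ := growth_pos R₀
  have hg : 1 < growth J ν a := by
    rw [growth, one_lt_div hg0, ← sub_pos]
    rw [div_lt_iff₀ hden] at hl
    have : a - (a * ν / J + 1 - a) = (a * (2 * J - ν) - J) / J := by
      field_simp
      ring
    rw [this]
    exact div_pos (by linarith) (by linarith)
  have hC := mixTime_nonneg R₀ hfill
  have hloss : 0 ≤ lossRate J ν a := by
    unfold lossRate
    positivity
  -- The second term makes the losses at most half of `growth J ν a - 1`, leaving the factor `(1 +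
  -- growth J ν a) / 2`.
  set ε := min (1 / (4 * (J : ℝ) + 5)) ((growth J ν a - 1) / (2 * (lossRate J ν a + 1))) with hεdef
  have hε : 0 < ε := lt_min (by positivity) (div_pos (by linarith) (by linarith))
  have hε1 : (4 * J + 4) * ε < 1 := by
    have : ε * (4 * J + 5) ≤ 1 := by
      rw [← le_div_iff₀ (by positivity)]
      exact min_le_left _ _
    linarith
  have hε2 : lossRate J ν a * ε ≤ (growth J ν a - 1) / 2 := by
    have : ε * (2 * (lossRate J ν a + 1)) ≤ growth J ν a - 1 := by
      rw [← le_div_iff₀ (by linarith)]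
      exact min_le_right _ _
    linarith
  have hw : 0 < 1 - a - a / ν := by linarith
  refine ⟨ε, (1 + growth J ν a) / 2, (1 / a + 1 / (1 - a) + 2) / (1 - a - a / ν) + 1, ?_⟩
  filter_upwards [Filter.eventually_ge_atTop (J * (ν : ℝ) ^ 2 / ε), Filter.eventually_ge_atTop 1,
    Filter.eventually_gt_atTop (2 * ∑ k, realQ x₀ k)] with n₀ h1 h2 h3
  refine ⟨fun n hn => hR _ ?_, hfill, hε, hε1, by linarith, by linarith, h2, by linarith, ?_⟩
  · rw [div_le_iff₀ hε] at h1
    nlinarith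
  · rw [add_sub_cancel_right, div_mul_cancel₀ _ hw.ne']

theorem isTransient_step (hν : 1 < ν) (hJ : ν < J) (ha : a * (1 + 1 / (ν : ℝ)) < 1)
    (hl : (J : ℝ) / (2 * J - ν) < a)
    (hu : a < 1 - ((J : ℝ) + ν) * (J + (ν : ℝ) ^ 2) / (ν * ((J : ℝ) ^ 2 + J + (ν : ℝ) ^ 2)))
    {pol : (Queue J → ℕ) → PMF (Queue J → ℕ)} (hpol : (twoComponent J ν).IsMaxWeight pol) :
    IsTransient ((twoComponent J ν).step (twoComponentArrivals J a) pol) := by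
  intro x
  obtain ⟨ε, g, T, hS⟩ := exists_scales hν hJ ha hl hu x
  obtain ⟨n₀, H, hn₀⟩ := (hS.and (Filter.eventually_gt_atTop (escapeConst J ε g T))).exists
  have R := H.regime n₀ le_rfl
  obtain ⟨z, hz, hz'⟩ := exists_reachable_cycleStart hν hJ R.a_pos R.a_lt hpol x H.ε_pos n₀
  refine hitProb_lt_one_of_reachable (c := ENNReal.ofReal
    (escapeConst J ε g T / cycleWeight a false (realQ z))) ?_
    (fun k => hitWithin_le H hν hJ hpol k hz') hz
  rw [← ENNReal.ofReal_one]
  refine (ENNReal.ofReal_lt_ofReal_iff one_pos).2 ?_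
  have h1 := hz'.weight_ge
  rw [div_lt_one (by linarith [H.one_le])]
  linarith

lemma not_isPositiveRecurrent_of_isTransient {S : Type} [Countable S] [MeasurableSpace S]
    [MeasurableSingletonClass S] {P : S → PMF S} (h : IsTransient P) : ¬ IsPositiveRecurrent P := by
  rintro ⟨y, hy, -⟩
  exact (h y).ne (hy y)

end Transience

/-! ### The traffic intensity -/

section Intensity

open scoped Pointwise

variable {J ν : ℕ} {a : ℝ}

lemma rate_none (c : Bool) : (twoComponentArrivals J a).rate (c, none) = 0 := by
  have : (twoComponentArrivals J a).law (c, none) = PMF.pure 0 := rfl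
  rw [ExternalArrivals.rate, this]
  have h := pmfExp_pure 0 (fun n : ℕ => (n : ℝ≥0∞))
  rw [pmfExp] at h
  rw [h]
  simp

lemma rate_some (h0 : 0 ≤ a / J) (h1 : a / J ≤ 1) (c : Bool) (j : Fin J) :
    (twoComponentArrivals J a).rate (c, some j) = a / J := by
  have hlaw : (twoComponentArrivals J a).law (c, some j) =
      (coin (a / J)).map fun b => if b then 1 else 0 := rfl
  have h2 : ENNReal.ofReal (a / J) ≤ 1 := by
    rw [← ENNReal.ofReal_one]
    exact ENNReal.ofReal_le_ofReal h1
  have ht : coin (a / J) true = ENNReal.ofReal (a / J) := by simp [coin, h2]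
  have h := pmfExp_map (coin (a / J)) (fun b => if b then 1 else 0) (fun n : ℕ => (n : ℝ≥0∞))
  rw [pmfExp] at h
  rw [ExternalArrivals.rate, hlaw, h, pmfExp, tsum_fintype, Fintype.sum_bool, ht]
  simp [ENNReal.toReal_ofReal h0]

lemma trafficIntensity_twoComponent (h0 : 0 ≤ a / J) (h1 : a / J ≤ 1) (hJ : 0 < J)
    (k : Queue J) :
    (twoComponent J ν).trafficIntensity (twoComponentArrivals J a) k =
      k.2.elim a (fun _ => a / J) := by
  set P := (twoComponent J ν).routingMatrix with hP
  have hPapp : ∀ i j, P i j = if nextQueue J i = some j then 1 else 0 := by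
    intro i j
    have : P i j = (PMF.pure (nextQueue J i) (some j)).toReal := rfl
    rw [this, PMF.pure_apply]
    by_cases h : nextQueue J i = some j
    · simp [h]
    · rw [if_neg h, if_neg fun h' => h h'.symm, ENNReal.toReal_zero]
  -- Every route visits at most two queues, so the Neumann series for the inverse stops after `P`.
  have hPP : P * P = 0 := by
    ext i k
    rw [Matrix.mul_apply]
    refine Finset.sum_eq_zero fun j _ => ?_
    obtain ⟨c, _ | i⟩ := i
    · simp [hPapp, nextQueue]
    · obtain ⟨d, _ | j⟩ := j <;> simp [hPapp, nextQueue]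
  have hinv : (1 - P)⁻¹ = 1 + P := by
    refine Matrix.inv_eq_right_inv ?_
    rw [sub_mul, mul_add, mul_add, hPP]
    simp
  have hsucc : (twoComponent J ν).success k = 1 := rfl
  rw [SwitchedNetwork.trafficIntensity, SwitchedNetwork.totalRate, ← hP, hinv, hsucc, div_one,
    Matrix.vecMul_add, Matrix.vecMul_one, Pi.add_apply, Matrix.vecMul, dotProduct,
    Fintype.sum_prod_type, Fintype.sum_bool, Fintype.sum_option, Fintype.sum_option]
  simp only [hPapp, rate_none, rate_some h0 h1]
  have hJ' : (J : ℝ) ≠ 0 := by positivity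
  obtain ⟨c, _ | j⟩ := k
  · rw [rate_none]
    cases c <;> simp [nextQueue] <;> field_simp
  · rw [rate_some h0 h1]
    cases c <;> simp [nextQueue]

/-- The part of a rate vector in component `c` is a mixture of schedules serving only `c`. -/
lemma component_mem_convexHull (hν : 0 < ν) {x : Queue J → ℝ} (hx : ∀ k, 0 ≤ x k) (c : Bool)
    (hc : x (c, none) + 1 / ν * ∑ j, x (c, some j) ≤ 1) :
    (fun k => if k.1 = c then x k else 0) ∈ convexHull ℝ
      ((fun σ : Queue J → ℕ => fun k => (σ k : ℝ)) ''
        {σ | σ ∈ (twoComponent J ν).schedules ∧ ∀ j, σ (!c, j) = 0}) := by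
  have hν' : (0 : ℝ) < ν := by exact_mod_cast hν
  set V : Set (Queue J → ℝ) := (fun σ : Queue J → ℕ => fun k => (σ k : ℝ)) ''
        {σ | σ ∈ (twoComponent J ν).schedules ∧ ∀ j, σ (!c, j) = 0} with hV
  let p : Option (Fin J) → Queue J → ℕ := fun i => Pi.single (c, i) (i.elim 1 fun _ => ν)
  have hp : ∀ i, (fun k => (p i k : ℝ)) ∈ V := by
    intro i
    refine ⟨p i, ⟨(mem_schedules_iff hν _).2 fun d => ?_, fun j => ?_⟩, rfl⟩
    · by_cases hd : d = c
      · subst hd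
        cases i with
        | none => simp [p]
        | some i => simp [p, Pi.single_apply]
      · simp [p, hd]
    · simp [p]
  have h0 : (0 : Queue J → ℝ) ∈ V :=
    ⟨0, ⟨(mem_schedules_iff hν _).2 fun d => by simp, fun j => rfl⟩, by ext; simp⟩
  -- Weights for the schedules that serve one queue at full rate; the zero schedule takes the
  -- remaining mass.
  let w : Option (Fin J) → ℝ := fun i => i.elim (x (c, none)) fun j => x (c, some j) / ν
  have hw : ∀ i, 0 ≤ w i := by
    rintro (_ | j)
    · exact hx _
    · exact div_nonneg (hx _) hν'.le
  have hwsum : ∑ i, w i ≤ 1 := by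
    rw [Fintype.sum_option]
    refine le_trans (le_of_eq ?_) hc
    simp only [w, Option.elim, div_eq_inv_mul, Finset.mul_sum, mul_one]
  have key := (convex_convexHull ℝ V).sum_mem (t := Finset.univ)
    (w := fun i : Option (Option (Fin J)) => i.elim (1 - ∑ i, w i) w)
    (z := fun i => i.elim 0 fun i k => (p i k : ℝ))
    (by
      rintro (_ | i) -
      · simpa using hwsum
      · exact hw i)
    (by rw [Fintype.sum_option]; simp)
    (by
      rintro (_ | i) -
      · exact subset_convexHull ℝ V h0
      · exact subset_convexHull ℝ V (hp i))
  convert! key using 1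
  ext ⟨d, k⟩
  rw [Fintype.sum_option]
  simp only [Option.elim, smul_zero, zero_add, Finset.sum_apply, Pi.smul_apply, smul_eq_mul]
  by_cases hd : d = c
  · subst hd
    rw [Finset.sum_eq_single k]
    · cases k with
      | none => simp [p, w]
      | some j => simp [p, w, hν'.ne']
    · intro i _ hi
      simp [p, hi.symm]
    · simp
  · simp [p, hd]

/-- Schedules supported on different components add up to schedules, and the convex hull commutes
with Minkowski sums. -/
lemma mem_convexHull_schedules (hν : 0 < ν) {x : Queue J → ℝ} (hx : ∀ k, 0 ≤ x k)
    (hc : ∀ c, x (c, none) + 1 / ν * ∑ j, x (c, some j) ≤ 1) :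
    x ∈ convexHull ℝ ((fun σ : Queue J → ℕ => fun j => (σ j : ℝ)) ''
      (twoComponent J ν).schedules) := by
  have h1 := component_mem_convexHull hν hx true (hc true)
  have h2 := component_mem_convexHull hν hx false (hc false)
  have h3 := Set.add_mem_add h1 h2
  rw [← convexHull_add] at h3
  have hxe : x = (fun k : Queue J => if k.1 = true then x k else 0)
      + fun k : Queue J => if k.1 = false then x k else 0 := by
    ext ⟨c, k⟩
    cases c <;> simp
  rw [hxe]
  refine convexHull_mono ?_ h3
  rintro _ ⟨_, ⟨σ, ⟨hσ, hσ0⟩, rfl⟩, _, ⟨τ, ⟨hτ, hτ0⟩, rfl⟩, rfl⟩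
  refine ⟨σ + τ, (mem_schedules_iff hν _).2 fun c => ?_, by ext; simp⟩
  cases c
  · have h4 : ∀ j, σ (false, j) = 0 := hσ0
    simpa [h4] using (mem_schedules_iff hν _).1 hτ false
  · have h4 : ∀ j, τ (true, j) = 0 := hτ0
    simpa [h4] using (mem_schedules_iff hν _).1 hσ true

theorem trafficIntensity_mem_subcriticalRegion (hν : 0 < ν) (hJ : 0 < J) (ha0 : 0 < a)
    (ha : a * (1 + 1 / (ν : ℝ)) < 1) :
    (twoComponent J ν).trafficIntensity (twoComponentArrivals J a) ∈
      (twoComponent J ν).subcriticalRegion := by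
  have hν' : (0 : ℝ) < ν := by exact_mod_cast hν
  have hJ' : (1 : ℝ) ≤ J := by exact_mod_cast hJ
  have h0 : 0 < a / J := by positivity
  have ha' : a + 1 / ν * a < 1 := by linarith
  have h1 : a / J ≤ 1 := by
    rw [div_le_one (by linarith)]
    have : 0 < 1 / ν * a := by positivity
    linarith
  let U : Set (Queue J → ℝ) := (⋂ k, {x | 0 < x k}) ∩
    ⋂ c, {x | x (c, none) + 1 / ν * ∑ j, x (c, some j) < 1}
  have hU : IsOpen U := by
    refine (isOpen_iInter_of_finite fun k => ?_).inter (isOpen_iInter_of_finite fun c => ?_)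
    · exact isOpen_lt (by fun_prop) (by fun_prop)
    · exact isOpen_lt (by fun_prop) (by fun_prop)
  refine mem_interior.2 ⟨U, fun x hx => ?_, hU, ?_⟩
  · have h2 := Set.mem_iInter.1 hx.1
    have h3 := Set.mem_iInter.1 hx.2
    exact mem_convexHull_schedules hν (fun k => (h2 k).le) fun c => (h3 c).le
  · refine ⟨Set.mem_iInter.2 fun k => ?_, Set.mem_iInter.2 fun c => ?_⟩
    · rw [Set.mem_ofPred_eq, trafficIntensity_twoComponent h0.le h1 hJ]
      obtain ⟨c, _ | j⟩ := k
      exacts [ha0, h0]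
    · simp only [Set.mem_ofPred_eq, trafficIntensity_twoComponent h0.le h1 hJ, Option.elim, Finset.sum_const,
        Finset.card_univ, Fintype.card_fin, nsmul_eq_mul]
      rwa [mul_div_cancel₀ _ (by linarith)]

end Intensity

/-! ### Existence of MaxWeight policies and conclusion -/

lemma exists_isMaxWeight {J ν : ℕ} (hν : 0 < ν) : ∃ pol, (twoComponent J ν).IsMaxWeight pol := by
  have hfin : (twoComponent J ν).schedules.Finite := by
    refine (Set.finite_Iic (fun _ : Queue J => ν)).subset fun σ hσ k => ?_
    obtain ⟨c, k⟩ := k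
    have h := (mem_schedules_iff hν σ).1 hσ c
    cases k with
    | none =>
      have := Nat.le_mul_of_pos_left (σ (c, none)) hν
      dsimp only
      omega
    | some j =>
      have := Finset.single_le_sum (f := fun j => σ (c, some j)) (fun _ _ => Nat.zero_le _)
        (Finset.mem_univ j)
      dsimp only at this ⊢
      omega
  choose σ hσ hmax using fun Q : Queue J → ℕ => Set.exists_max_image _
    (fun σ : Queue J → ℕ => ∑ j, Q j * σ j) hfin (twoComponent J ν).schedules_nonempty
  refine ⟨fun Q => PMF.pure (σ Q), fun Q τ hτ => ?_⟩
  rw [PMF.mem_support_pure_iff] at hτ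
  exact hτ ▸ ⟨hσ Q, hmax Q⟩

lemma isMultihop_twoComponent {J ν : ℕ} (hJ : 0 < J) : (twoComponent J ν).IsMultihop := by
  refine ⟨(true, some ⟨0, hJ⟩), ?_⟩
  have : (twoComponent J ν).route (true, some ⟨0, hJ⟩) = PMF.pure (some (false, none)) := rfl
  rw [this]
  simp

/-- Under the assumptions on the parameters, the traffic intensity is subcritical, but every
MaxWeight policy is transient. -/
theorem subcritical_and_transient {J ν : ℕ} {a : ℝ} (ha : a * (1 + 1 / (ν : ℝ)) < 1)
    (hν : 1 < ν) (hJ : ν < J) (hl : (J : ℝ) / (2 * J - ν) < a)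
    (hu : a < 1 - ((J : ℝ) + ν) * (J + (ν : ℝ) ^ 2) / (ν * ((J : ℝ) ^ 2 + J + (ν : ℝ) ^ 2))) :
    (twoComponent J ν).trafficIntensity (twoComponentArrivals J a) ∈
        (twoComponent J ν).subcriticalRegion ∧
      ∀ pol : (Queue J → ℕ) → PMF (Queue J → ℕ), (twoComponent J ν).IsMaxWeight pol →
        IsTransient ((twoComponent J ν).step (twoComponentArrivals J a) pol) ∧
          ¬ (twoComponent J ν).IsMaximallyStable pol := by
  have ha0 : 0 < a := by
    have hJν : (ν : ℝ) + 1 ≤ J := by exact_mod_cast hJ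
    have hν0 : (0 : ℝ) ≤ ν := Nat.cast_nonneg ν
    exact lt_of_le_of_lt (div_nonneg (by linarith) (by linarith)) hl
  have hρ := trafficIntensity_mem_subcriticalRegion (J := J) (ν := ν) (by omega) (by omega) ha0 ha
  refine ⟨hρ, fun pol hpol => ?_⟩
  have ht := isTransient_step hν hJ ha hl hu hpol
  exact ⟨ht, fun hs => not_isPositiveRecurrent_of_isTransient ht (hs _ hρ)⟩

end MaxWeightNetwork

end

open MaxWeightNetwork in
theorem theorem1 :
    (∀ (J ν : ℕ) (a : ℝ),
      a * (1 + 1 / (ν : ℝ)) < 1 →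
      1 < ν → ν < J →
      (J : ℝ) / (2 * J - ν) < a →
      a < 1 - ((J : ℝ) + ν) * (J + (ν : ℝ) ^ 2) / (ν * ((J : ℝ) ^ 2 + J + (ν : ℝ) ^ 2)) →
      (twoComponent J ν).trafficIntensity (twoComponentArrivals J a) ∈
          (twoComponent J ν).subcriticalRegion ∧
        ∀ pol : (Queue J → ℕ) → PMF (Queue J → ℕ), (twoComponent J ν).IsMaxWeight pol →
          IsTransient ((twoComponent J ν).step (twoComponentArrivals J a) pol) ∧
            ¬ (twoComponent J ν).IsMaximallyStable pol) ∧
    (∃ (ι : Type) (_ : Fintype ι) (_ : DecidableEq ι) (N : SwitchedNetwork ι),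
      N.IsMultihop ∧ (∃ pol, N.IsMaxWeight pol) ∧
        ∀ pol, N.IsMaxWeight pol → ¬ N.IsMaximallyStable pol) := by
  refine ⟨fun J ν a ha hν hJ hl hu => subcritical_and_transient ha hν hJ hl hu,
    Queue 100, inferInstance, inferInstance, twoComponent 100 3,
    isMultihop_twoComponent (by norm_num), exists_isMaxWeight (by norm_num), fun pol hpol => ?_⟩
  refine ((subcritical_and_transient (J := 100) (ν := 3) (a := 3 / 5) ?_ ?_ ?_ ?_ ?_).2 pol
    hpol).2 <;> norm_num
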